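/- Let $n\ge 2$, let $S\in\mathbb R^{n\times n}$ be symmetric positive definite and $T\in\mathbb R^{n\times n}$ skew-symmetric ($T^T=-T$), and put $A^\varepsilon=S+\varepsilon T$ for $\varepsilon>0$ and $M^\varepsilon=(A^\varepsilon)^{-1}$. $\mathbb R^n$ carries the Euclidean inner product $\langle\cdot,\cdot\rangle$ and norm, and $\|\cdot\|$ also denotes the associated operator norm. Let $\lambda_{S,1}\le\lambda_{S,2}\le\dots\le\lambda_{S,n}$ be the eigenvalues of $S$ counted with multiplicity, $k_S=1/\lambda_{S,1}$, $k_{S,2}=1/\lambda_{S,2}$, and let $u_S$ be a unit eigenvector of $S$ for $\lambda_{S,1}$. Let $k_N\in\mathbb R$ be independent of $\varepsilon$ with $$k_S\ge k_N>k_{S,2}>0,$$ and assume that $\lambda_{S,2}$ is a simple eigenvalue of $S$ ($\lambda_{S,1}$ is then simple as well). Then for all sufficiently small $\varepsilon>0$ the matrix $A^\varepsilon$ is invertible and has a positive, simple eigenvalue $\lambda^\varepsilon$ whose modulus is strictly smaller than that of all its other complex eigenvalues, and there are unit vectors $u^\varepsilon,u^{*,\varepsilon}$ with $A^\varepsilon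 u^\varepsilon=\lambda^\varepsilon u^\varepsilon$, $(A^\varepsilon)^Tu^{*,\varepsilon}=\lambda^\varepsilon u^{*,\varepsilon}$ and $\langle u^\varepsilon,u_S\rangle>0$. For any such choice put $k^\varepsilon=1/\lambda^\varepsilon$, $\tilde u^{*,\varepsilon}=(A^\varepsilon)^Tu^{*,\varepsilon}/\|(A^\varepsilon)^Tu^{*,\varepsilon}\|$, $$P^\varepsilon=I-\frac{u^\varepsilon(\tilde u^{*,\varepsilon})^T}{\langle u^\varepsilon,\tilde u^{*,\varepsilon}\rangle},\qquad P^{*,\varepsilon}=I-\frac{\tilde u^{*,\varepsilon}(u^\varepsilon)^T}{\langle u^\varepsilon,\tilde u^{*,\varepsilon}\rangle},$$ let $(P^\varepsilon M^\varepsilon P^\varepsilon-k_NI)^+$ be the linear map that is the inverse of $P^\varepsilon M^\varepsilon P^\varepsilon-k_NI$ on $[\mathrm{Span}\{\tilde u^{*,\varepsilon}\}]^\perp$ (as an operator of this space onto itself) and $0$ on $\mathrm{Span}\{u^\varepsilon\}$, and let $(P^{*,\varepsilon}(M^\varepsilon)^TP^{*,\varepsilon}-k_NI)^+$ be the linear map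 that is the inverse of $P^{*,\varepsilon}(M^\varepsilon)^TP^{*,\varepsilon}-k_NI$ on $[\mathrm{Span}\{u^\varepsilon\}]^\perp$ and $0$ on $\mathrm{Span}\{\tilde u^{*,\varepsilon}\}$. For $\varepsilon$ small enough these objects are well defined, and the prefactor $$C_N^{k,\varepsilon}=\Big\|\big[P^{*,\varepsilon}(P^{*,\varepsilon}(M^\varepsilon)^TP^{*,\varepsilon}-k_NI)^+P^{*,\varepsilon}\big]^T(M^\varepsilon-k^\varepsilon I)\,P^\varepsilon(P^\varepsilon M^\varepsilon P^\varepsilon-k_NI)^+P^\varepsilon(A^\varepsilon)^{-1}\Big\|$$ satisfies $$C_N^{k,\varepsilon}=\frac{k_{S,2}(k_S-k_{S,2})}{(k_N-k_{S,2})^2}+O(\varepsilon^2)\qquad(\varepsilon\to0^+),$$ that is, there are $\varepsilon_0>0$ and $K$, depending only on $S$, $T$ and $k_N$, such that the two sides differ by at most $K\varepsilon^2$ for all $0<\varepsilon<\varepsilon_0$ and every choice of the eigenvectors as above. -/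

import Mathlib

open scoped Matrix

noncomputable section

namespace NonsymEig

variable {n : ℕ}

/-- The Euclidean norm of a vector of `ℝⁿ` (the bare type `Fin n → ℝ` carries the sup norm). -/
def eucNorm (v : Fin n → ℝ) : ℝ := ‖WithLp.toLp 2 v‖

/-- The operator norm of a matrix associated with the Euclidean vector norm. -/
def opNorm (X : Matrix (Fin n) (Fin n) ℝ) : ℝ := ‖Matrix.toEuclideanCLM (𝕜 := ℝ) X‖

/-- `lam 0 ≤ lam 1 ≤ …` are all the eigenvalues of `S`, repeated according to multiplicity. -/
def IsOrderedSpectrum (S : Matrix (Fin n) (Fin n) ℝ) (lam : Fin n → ℝ) : Prop :=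
  Monotone lam ∧ S.charpoly = ∏ i, (Polynomial.X - Polynomial.C (lam i))

/-- `A` is invertible and `lam` is a positive, (algebraically) simple eigenvalue of `A`, whose
modulus is strictly smaller than that of every other complex eigenvalue of `A`. -/
structure IsPrincipalEigenvalue (A : Matrix (Fin n) (Fin n) ℝ) (lam : ℝ) : Prop where
  isUnit_det : IsUnit A.det
  pos : 0 < lam
  simple : A.charpoly.rootMultiplicity lam = 1
  lt_norm : ∀ z : ℂ, (A.map (algebraMap ℝ ℂ)).charpoly.IsRoot z → z ≠ (lam : ℂ) → lam < ‖z‖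

/-- `(lam, u, us)` solves the direct and the adjoint eigenvalue problems of `A` (with `B = I`)
for the eigenvalue of smallest modulus, with unit eigenvectors. -/
structure IsEigenSolution (A : Matrix (Fin n) (Fin n) ℝ) (lam : ℝ) (u us : Fin n → ℝ) :
    Prop where
  principal : IsPrincipalEigenvalue A lam
  direct : A *ᵥ u = lam • u
  norm_direct : eucNorm u = 1
  adjoint : Aᵀ *ᵥ us = lam • us
  norm_adjoint : eucNorm us = 1

/-- The vector `Aᵀ u* / ‖Aᵀ u*‖`. -/
def tildeVec (A : Matrix (Fin n) (Fin n) ℝ) (us : Fin n → ℝ) : Fin n → ℝ :=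
  (eucNorm (Aᵀ *ᵥ us))⁻¹ • (Aᵀ *ᵥ us)

/-- The matrix `I - a bᵀ / ⟨a, b⟩`: the projection onto `[Span b]^⊥` along `Span a`. -/
def proj (a b : Fin n → ℝ) : Matrix (Fin n) (Fin n) ℝ :=
  1 - (a ⬝ᵥ b)⁻¹ • Matrix.vecMulVec a b

/-- `G` is the inverse of `Q` on `[Span b]^⊥`, seen as an operator from this space onto itself,
and vanishes on `Span a`. -/
structure IsReducedInverse (Q : Matrix (Fin n) (Fin n) ℝ) (a b : Fin n → ℝ)
    (G : Matrix (Fin n) (Fin n) ℝ) : Prop where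
  mapsTo : ∀ v, b ⬝ᵥ v = 0 → b ⬝ᵥ (G *ᵥ v) = 0
  right_inv : ∀ v, b ⬝ᵥ v = 0 → Q *ᵥ (G *ᵥ v) = v
  left_inv : ∀ v, b ⬝ᵥ v = 0 → G *ᵥ (Q *ᵥ v) = v
  apply_eq_zero : G *ᵥ a = 0

open Classical in
/-- The operator `Q⁺` equal to the inverse of `Q` on `[Span b]^⊥` and to `0` on `Span a`
(with the junk value `0` if there is no such operator). -/
def reducedInverse (Q : Matrix (Fin n) (Fin n) ℝ) (a b : Fin n → ℝ) :
    Matrix (Fin n) (Fin n) ℝ :=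
  if h : ∃ G, IsReducedInverse Q a b G then h.choose else 0

/-- The operator `P M P - k_N I`, where `M = A⁻¹`, `P = I - u wᵀ / ⟨u, w⟩`. -/
def directOp (A : Matrix (Fin n) (Fin n) ℝ) (kN : ℝ) (u w : Fin n → ℝ) :
    Matrix (Fin n) (Fin n) ℝ :=
  proj u w * A⁻¹ * proj u w - kN • 1

/-- The operator `P* Mᵀ P* - k_N I`, where `M = A⁻¹`, `P* = I - w uᵀ / ⟨u, w⟩`. -/
def adjointOp (A : Matrix (Fin n) (Fin n) ℝ) (kN : ℝ) (u w : Fin n → ℝ) :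
    Matrix (Fin n) (Fin n) ℝ :=
  proj w u * (A⁻¹)ᵀ * proj w u - kN • 1

/-- All the divisions and inverses in the definition of the prefactor are meaningful. -/
structure PrefactorWellDefined (A : Matrix (Fin n) (Fin n) ℝ) (kN : ℝ) (u w : Fin n → ℝ) :
    Prop where
  inner_ne_zero : u ⬝ᵥ w ≠ 0
  direct : ∃! G, IsReducedInverse (directOp A kN u w) u w G
  adjoint : ∃! G, IsReducedInverse (adjointOp A kN u w) w u G

/-- The prefactor
`‖[P* (P* Mᵀ P* - k_N I)⁺ P*]ᵀ (M - k I) P (P M P - k_N I)⁺ P A⁻¹‖` for `B = I`, so `M = A⁻¹`,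
where `u`, `w` are the direct eigenvector and the normalized adjoint vector `tildeVec A us`. -/
def prefactor (A : Matrix (Fin n) (Fin n) ℝ) (k kN : ℝ) (u w : Fin n → ℝ) : ℝ :=
  opNorm
    ((proj w u * reducedInverse (adjointOp A kN u w) w u * proj w u)ᵀ
      * (A⁻¹ - k • 1)
      * (proj u w * reducedInverse (directOp A kN u w) u w * proj u w)
      * A⁻¹)

/-- The value `k₂ (k - k₂) / (k_N - k₂)²` of the prefactor in the symmetric case. -/
def symPrefactor (k k₂ kN : ℝ) : ℝ := k₂ * (k - k₂) / (kN - k₂) ^ 2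

end NonsymEig

end

noncomputable section

namespace NonsymEig

open scoped Matrix.Norms.L2Operator
open Filter Topology Asymptotics

variable {n : ℕ}

/-! Write `c` for `k_N`, `N = P M P` and `R = (N - c)⁻¹`. The left and right eigenvectors make `P`
commute with `M`, hence with `R`, and the matrix inside the norm collapses to `N (N - k) R² = 1 +
(2c - k) R + c (c - k) R²` (`prefactor_eq_norm`). The reduced inverses thus become an ordinary
inverse.

Call an expansion `Y₀ + ε Y₁ + O(ε²)` with `Y₀` symmetric and `Y₁` skew a skew expansion. Such
expansions survive sums, inverses, squares and multiplication by scalars without first-order term.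
`S + εT` has one, and so does its spectral projection (`SkewExpansion.eigenprojection`). The
eigenvalue moves only by `O(ε²)`, because the quadratic form of `S + εT` is that of `S`. Hence the
matrix above has a skew expansion. Its limit is symmetric, with eigenvalues `x (x - k) / (x - c)²`,
where `x = 0` or `x = 1 / λ_i` with `i ≥ 2`. These are nonpositive and the most negative one, at `x
= k_{S,2}`, is minus the claimed value.

It remains that a skew first-order perturbation changes the norm of a symmetric negative
semidefinite matrix only to second order (`abs_norm_specFun_add_sub_le`). The sign matters: were the
norm attained at eigenvalues of both signs, a skew term coupling their eigenvectors could act at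
first order.

Uniformity over the choice of eigenvectors comes from working along a filter on all tuples `(ε, λ,
u, u*)` that solve the eigenproblem. -/

/-- The matrix `U diag(g) Uᵀ`; for orthogonal `U` this is the symmetric matrix with
eigenvectors the columns of `U` and eigenvalues `g`. -/
def specFun (U : Matrix (Fin n) (Fin n) ℝ) (g : Fin n → ℝ) : Matrix (Fin n) (Fin n) ℝ :=
  U * Matrix.diagonal g * Uᵀ

/-- `S` and `diagonal lam` have the same characteristic polynomial, hence the same eigenvalues in
Mathlib's ordering. Composing the diagonalizer of one with the inverse of that of the other gives
`U`, with the order of `lam` preserved. -/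
theorem exists_eq_specFun {S : Matrix (Fin n) (Fin n) ℝ} (hS : S.IsHermitian) {lam : Fin n → ℝ}
    (h : S.charpoly = ∏ i, (Polynomial.X - Polynomial.C (lam i))) :
    ∃ U : Matrix (Fin n) (Fin n) ℝ, Uᵀ * U = 1 ∧ S = specFun U lam := by
  have hD : (Matrix.diagonal lam).IsHermitian := Matrix.isHermitian_diagonal _
  have he : hS.eigenvalues = hD.eigenvalues := by
    rw [Matrix.IsHermitian.eigenvalues_eq_eigenvalues_iff, h, Matrix.charpoly_diagonal]
  have h1 := hS.spectral_theorem
  have h2 := hD.spectral_theorem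
  rw [Unitary.conjStarAlgAut_apply] at h1 h2
  rw [← he] at h2
  set V := hS.eigenvectorUnitary
  set W := hD.eigenvectorUnitary
  have hV := Unitary.coe_star_mul_self V
  have hW := Unitary.coe_star_mul_self W
  have hW' := Unitary.coe_mul_star_self W
  set E : Matrix (Fin n) (Fin n) ℝ := Matrix.diagonal (RCLike.ofReal ∘ hS.eigenvalues)
  have key : ∀ X : Matrix (Fin n) (Fin n) ℝ, Xᵀ = star X := fun X => by
    rw [Matrix.star_eq_conjTranspose, Matrix.conjTranspose_eq_transpose_of_trivial]
  refine ⟨V * star (W : Matrix (Fin n) (Fin n) ℝ), ?_, ?_⟩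
  · rw [key, star_mul, star_star]
    calc _ = (W : Matrix (Fin n) (Fin n) ℝ) * (star (V : Matrix (Fin n) (Fin n) ℝ) * V)
            * star (W : Matrix (Fin n) (Fin n) ℝ) := by
          noncomm_ring
      _ = _ := by rw [hV, mul_one]; exact hW'
  · rw [specFun, key, star_mul, star_star, h2, h1]
    calc _ = (V : Matrix (Fin n) (Fin n) ℝ) * (1 * E * 1) * star (V : Matrix (Fin n) (Fin n) ℝ) := by
          noncomm_ring
      _ = _ := by rw [← hW]; noncomm_ring

/-! ### Calculus of matrices diagonal in a fixed orthonormal basis -/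

section specFun

variable {U : Matrix (Fin n) (Fin n) ℝ}

theorem specFun_mul (hU : Uᵀ * U = 1) (g h : Fin n → ℝ) :
    specFun U g * specFun U h = specFun U (g * h) := by
  have : specFun U g * specFun U h
      = U * (Matrix.diagonal g * (Uᵀ * U) * Matrix.diagonal h) * Uᵀ := by
    simp only [specFun, mul_assoc]
  rw [this, hU, mul_one, Matrix.diagonal_mul_diagonal]
  rfl

theorem specFun_add (g h : Fin n → ℝ) : specFun U g + specFun U h = specFun U (g + h) := by
  rw [specFun, specFun, specFun, ← add_mul, ← mul_add, Matrix.diagonal_add]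
  rfl

theorem specFun_smul (a : ℝ) (g : Fin n → ℝ) : a • specFun U g = specFun U (a • g) := by
  simp [specFun]

theorem specFun_sub (g h : Fin n → ℝ) : specFun U g - specFun U h = specFun U (g - h) := by
  rw [specFun, specFun, specFun, ← sub_mul, ← mul_sub, Matrix.diagonal_sub]
  rfl

theorem specFun_one (hU : Uᵀ * U = 1) : specFun U 1 = 1 := by
  have : specFun U 1 = U * Uᵀ := by simp [specFun]
  rw [this, mul_eq_one_comm.1 hU]

theorem specFun_transpose (g : Fin n → ℝ) : (specFun U g)ᵀ = specFun U g := by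
  simp [specFun, Matrix.transpose_mul, mul_assoc]

theorem transpose_mulVec_specFun (hU : Uᵀ * U = 1) (g v : Fin n → ℝ) :
    Uᵀ *ᵥ (specFun U g *ᵥ v) = g * (Uᵀ *ᵥ v) := by
  rw [specFun, Matrix.mulVec_mulVec, ← mul_assoc, ← mul_assoc, hU, one_mul, ← Matrix.mulVec_mulVec]
  ext i
  simp [Matrix.mulVec_diagonal]

theorem dotProduct_transpose_mulVec (hU : Uᵀ * U = 1) (v w : Fin n → ℝ) :
    (Uᵀ *ᵥ v) ⬝ᵥ (Uᵀ *ᵥ w) = v ⬝ᵥ w := by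
  rw [Matrix.dotProduct_mulVec, Matrix.vecMul_transpose, Matrix.mulVec_mulVec,
    mul_eq_one_comm.1 hU, Matrix.one_mulVec]

theorem dotProduct_specFun_mulVec (hU : Uᵀ * U = 1) (g v w : Fin n → ℝ) :
    v ⬝ᵥ (specFun U g *ᵥ w) = ∑ i, g i * ((Uᵀ *ᵥ v) i * (Uᵀ *ᵥ w) i) := by
  rw [← dotProduct_transpose_mulVec hU, transpose_mulVec_specFun hU]
  simp only [dotProduct, Pi.mul_apply]
  exact Finset.sum_congr rfl fun i _ => by ring

end specFun

/-! ### Euclidean norm and operator norm estimates -/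

section norms

theorem eucNorm_nonneg (v : Fin n → ℝ) : 0 ≤ eucNorm v := norm_nonneg _

theorem eucNorm_sq (v : Fin n → ℝ) : eucNorm v ^ 2 = v ⬝ᵥ v := by
  rw [eucNorm, EuclideanSpace.norm_sq_eq]
  simp [dotProduct, sq]

theorem eucNorm_smul (a : ℝ) (v : Fin n → ℝ) : eucNorm (a • v) = |a| * eucNorm v := by
  simp [eucNorm, norm_smul]

theorem abs_dotProduct_le (v w : Fin n → ℝ) : |v ⬝ᵥ w| ≤ eucNorm v * eucNorm w := by
  have := abs_real_inner_le_norm (WithLp.toLp 2 w) (WithLp.toLp 2 v)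
  rw [mul_comm]
  simpa [eucNorm, EuclideanSpace.inner_toLp_toLp] using this

theorem eucNorm_mulVec_le (X : Matrix (Fin n) (Fin n) ℝ) (v : Fin n → ℝ) :
    eucNorm (X *ᵥ v) ≤ ‖X‖ * eucNorm v :=
  Matrix.l2_opNorm_mulVec X (WithLp.toLp 2 v)

theorem dotProduct_mulVec_self_le (X : Matrix (Fin n) (Fin n) ℝ) (v : Fin n → ℝ) :
    (X *ᵥ v) ⬝ᵥ (X *ᵥ v) ≤ ‖X‖ ^ 2 * (v ⬝ᵥ v) := by
  rw [← eucNorm_sq, ← eucNorm_sq, ← mul_pow]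
  exact pow_le_pow_left₀ (eucNorm_nonneg _) (eucNorm_mulVec_le X v) 2

theorem abs_dotProduct_mulVec_le (X : Matrix (Fin n) (Fin n) ℝ) (v w : Fin n → ℝ) :
    |v ⬝ᵥ (X *ᵥ w)| ≤ ‖X‖ * (eucNorm v * eucNorm w) := by
  refine (abs_dotProduct_le _ _).trans ?_
  have := mul_le_mul_of_nonneg_left (eucNorm_mulVec_le X w) (eucNorm_nonneg v)
  linarith

theorem norm_le_of_eucNorm_mulVec_le {X : Matrix (Fin n) (Fin n) ℝ} {C : ℝ} (hC : 0 ≤ C)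
    (h : ∀ v, (X *ᵥ v) ⬝ᵥ (X *ᵥ v) ≤ C ^ 2 * (v ⬝ᵥ v)) : ‖X‖ ≤ C := by
  refine ContinuousLinearMap.opNorm_le_bound _ hC fun x => ?_
  have := h x.ofLp
  rw [← eucNorm_sq, ← eucNorm_sq, ← mul_pow] at this
  exact le_of_sq_le_sq this (mul_nonneg hC (norm_nonneg _))

theorem norm_transpose (X : Matrix (Fin n) (Fin n) ℝ) : ‖Xᵀ‖ = ‖X‖ := by
  rw [← Matrix.conjTranspose_eq_transpose_of_trivial, Matrix.l2_opNorm_conjTranspose]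

theorem norm_vecMulVec_le (v w : Fin n → ℝ) :
    ‖Matrix.vecMulVec v w‖ ≤ eucNorm v * eucNorm w := by
  refine norm_le_of_eucNorm_mulVec_le (mul_nonneg (eucNorm_nonneg _) (eucNorm_nonneg _)) fun x => ?_
  rw [← eucNorm_sq, ← eucNorm_sq, ← mul_pow]
  refine pow_le_pow_left₀ (eucNorm_nonneg _) ?_ 2
  have : Matrix.vecMulVec v w *ᵥ x = (w ⬝ᵥ x) • v := by
    rw [Matrix.vecMulVec_mulVec]; simp
  rw [this, eucNorm_smul]
  have := mul_le_mul_of_nonneg_right (abs_dotProduct_le w x) (eucNorm_nonneg v)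
  linarith

theorem abs_trace_le (X : Matrix (Fin n) (Fin n) ℝ) : |X.trace| ≤ n * ‖X‖ := by
  refine (Finset.abs_sum_le_sum_abs _ _).trans ?_
  have : ∀ i : Fin n, |X.diag i| ≤ ‖X‖ := fun i => by
    have := abs_dotProduct_mulVec_le X (Pi.single i 1) (Pi.single i 1)
    simpa [eucNorm] using this
  refine (Finset.sum_le_card_nsmul _ _ _ fun i _ => this i).trans ?_
  simp

end norms

/-! ### Norm of a semidefinite matrix under an almost skew perturbation -/

section perturbedNorm

variable {U : Matrix (Fin n) (Fin n) ℝ}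

/-- First-order perturbations of the symmetric matrix `specFun U f` by almost skew-symmetric
matrices change the norm only to second order, when the entries of `f` are nonpositive. -/
theorem abs_norm_specFun_add_sub_le (hU : Uᵀ * U = 1) {f : Fin n → ℝ} {j : Fin n}
    (hj : f j < 0) (hf : ∀ i, f j ≤ f i ∧ f i ≤ 0) (D : Matrix (Fin n) (Fin n) ℝ) :
    |‖specFun U f + D‖ + f j| ≤ ‖D + Dᵀ‖ + 2 * ‖D‖ ^ 2 / |f j| := by
  have habs : |f j| = - f j := abs_of_neg hj
  have hpos : 0 < |f j| := abs_pos.2 hj.ne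
  have hD : ∀ v, |v ⬝ᵥ (D *ᵥ v)| ≤ ‖D + Dᵀ‖ / 2 * (v ⬝ᵥ v) := fun v => by
    have h1 := abs_dotProduct_mulVec_le (D + Dᵀ) v v
    have h2 : v ⬝ᵥ ((D + Dᵀ) *ᵥ v) = 2 * (v ⬝ᵥ (D *ᵥ v)) := by
      rw [Matrix.add_mulVec, dotProduct_add, Matrix.mulVec_transpose, dotProduct_comm v (v ᵥ* D),
        ← Matrix.dotProduct_mulVec]
      ring
    rw [h2, abs_mul, abs_two, ← sq, eucNorm_sq] at h1
    linarith
  have hupper : ‖specFun U f + D‖ ≤ |f j| + (‖D + Dᵀ‖ + 2 * ‖D‖ ^ 2 / |f j|) := by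
    refine norm_le_of_eucNorm_mulVec_le (by positivity) fun v => ?_
    set y := Uᵀ *ᵥ v
    -- Splitting off `f j` isolates the term `f j * ⟨v, D v⟩`, which sees only the symmetric part of
    -- `D`. The rest of the cross term, `2⟨B v, D v⟩ ≤ |B v|² + |D v|²`, is absorbed by `e1`.
    set B := specFun U (f - fun _ => f j)
    have hB : specFun U f *ᵥ v = f j • v + B *ᵥ v := by
      have : specFun U f = f j • 1 + B := by
        rw [← specFun_one hU, specFun_smul, specFun_add]
        congr 1; ext i; simp
      rw [this, Matrix.add_mulVec, Matrix.smul_mulVec, Matrix.one_mulVec]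
    -- Here the sign is used: `a² + (a - b)² ≤ b²` for `b ≤ a ≤ 0`.
    have e1 : (specFun U f *ᵥ v) ⬝ᵥ (specFun U f *ᵥ v) + (B *ᵥ v) ⬝ᵥ (B *ᵥ v)
        ≤ |f j| ^ 2 * (v ⬝ᵥ v) := by
      rw [← dotProduct_transpose_mulVec hU (specFun U f *ᵥ v),
        ← dotProduct_transpose_mulVec hU (B *ᵥ v), ← dotProduct_transpose_mulVec hU v,
        transpose_mulVec_specFun hU, transpose_mulVec_specFun hU, sq_abs]
      simp only [dotProduct, Finset.mul_sum, ← Finset.sum_add_distrib]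
      refine Finset.sum_le_sum fun i _ => ?_
      simp only [Pi.mul_apply, Pi.sub_apply]
      have : 0 ≤ -f i * (f i - f j) :=
        mul_nonneg (by linarith [(hf i).2]) (by linarith [(hf i).1])
      nlinarith [mul_nonneg this (sq_nonneg (y i))]
    have e2 := hD v
    have e3 := dotProduct_mulVec_self_le D v
    have e4 : 0 ≤ (B *ᵥ v - D *ᵥ v) ⬝ᵥ (B *ᵥ v - D *ᵥ v) := by
      rw [← eucNorm_sq]; positivity
    have e5 : 0 ≤ v ⬝ᵥ v := by rw [← eucNorm_sq]; positivity
    have e6 : ((specFun U f + D) *ᵥ v) ⬝ᵥ ((specFun U f + D) *ᵥ v)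
        = (specFun U f *ᵥ v) ⬝ᵥ (specFun U f *ᵥ v) + 2 * f j * (v ⬝ᵥ (D *ᵥ v))
          + 2 * ((B *ᵥ v) ⬝ᵥ (D *ᵥ v)) + (D *ᵥ v) ⬝ᵥ (D *ᵥ v) := by
      have : (specFun U f *ᵥ v) ⬝ᵥ (D *ᵥ v)
          = f j * (v ⬝ᵥ (D *ᵥ v)) + (B *ᵥ v) ⬝ᵥ (D *ᵥ v) := by
        rw [hB, add_dotProduct, smul_dotProduct, smul_eq_mul]
      rw [Matrix.add_mulVec, dotProduct_add, add_dotProduct, add_dotProduct,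
        dotProduct_comm (D *ᵥ v) (specFun U f *ᵥ v), this]
      ring
    rw [sub_dotProduct, dotProduct_sub, dotProduct_sub, dotProduct_comm (D *ᵥ v) (B *ᵥ v)] at e4
    have e7 : 2 * f j * (v ⬝ᵥ (D *ᵥ v)) ≤ |f j| * (‖D + Dᵀ‖ * (v ⬝ᵥ v)) := by
      have h1 := le_abs_self (f j * (v ⬝ᵥ (D *ᵥ v)))
      rw [abs_mul] at h1
      have h2 := mul_le_mul_of_nonneg_left e2 hpos.le
      linarith
    have e8 : |f j| ^ 2 + |f j| * ‖D + Dᵀ‖ + 2 * ‖D‖ ^ 2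
        ≤ (|f j| + (‖D + Dᵀ‖ + 2 * ‖D‖ ^ 2 / |f j|)) ^ 2 := by
      have h1 : 2 * ‖D‖ ^ 2 = |f j| * (2 * ‖D‖ ^ 2 / |f j|) := by field_simp
      have h2 : 0 ≤ 2 * ‖D‖ ^ 2 / |f j| := by positivity
      have h3 : 0 ≤ ‖D + Dᵀ‖ := norm_nonneg _
      nlinarith [mul_nonneg hpos.le h2, mul_nonneg hpos.le h3]
    have e9 := mul_le_mul_of_nonneg_right e8 e5
    rw [e6]
    linarith
  -- Test the quadratic form on the `j`-th eigenvector, where `D` contributes only through `D + Dᵀ`.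
  have hlower : |f j| - ‖D + Dᵀ‖ / 2 ≤ ‖specFun U f + D‖ := by
    set b : Fin n → ℝ := U *ᵥ Pi.single j 1
    have hb : Uᵀ *ᵥ b = Pi.single j 1 := by
      simp only [b]
      rw [Matrix.mulVec_mulVec, hU, Matrix.one_mulVec]
    have hbb : b ⬝ᵥ b = 1 := by
      rw [← dotProduct_transpose_mulVec hU, hb]; simp
    have h1 : b ⬝ᵥ (specFun U f *ᵥ b) = f j := by
      rw [dotProduct_specFun_mulVec hU, hb]
      simp [Pi.single_apply]
    have h2 := abs_dotProduct_mulVec_le (specFun U f + D) b b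
    rw [← sq, eucNorm_sq, hbb, mul_one, Matrix.add_mulVec, dotProduct_add, h1] at h2
    have h3 := hD b
    rw [hbb, mul_one] at h3
    have h4 := neg_abs_le (f j + b ⬝ᵥ (D *ᵥ b))
    have h5 := le_abs_self (b ⬝ᵥ (D *ᵥ b))
    linarith
  have : 0 ≤ 2 * ‖D‖ ^ 2 / |f j| := by positivity
  have : 0 ≤ ‖D + Dᵀ‖ := norm_nonneg _
  rw [abs_le]
  constructor <;> linarith

end perturbedNorm

/-! ### Roots of the characteristic polynomial and quadratic forms -/

theorem exists_mulVec_eq_smul_of_isRoot_charpoly {K : Type*} [Field K]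
    {A : Matrix (Fin n) (Fin n) K} {t : K} (h : A.charpoly.IsRoot t) :
    ∃ v, v ≠ 0 ∧ A *ᵥ v = t • v := by
  rw [Polynomial.IsRoot, Matrix.eval_charpoly] at h
  obtain ⟨v, hv, hv'⟩ := Matrix.exists_mulVec_eq_zero_iff.2 h
  refine ⟨v, hv, ?_⟩
  rw [Matrix.sub_mulVec, sub_eq_zero] at hv'
  rw [← hv']
  ext i
  simp [Matrix.scalar_apply, Matrix.mulVec_diagonal]

theorem eucNorm_pos {v : Fin n → ℝ} (hv : v ≠ 0) : 0 < eucNorm v := by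
  rw [eucNorm, norm_pos_iff]
  simpa using hv

theorem exists_unit_eigenvector_of_isRoot_charpoly {A : Matrix (Fin n) (Fin n) ℝ} {t : ℝ}
    (h : A.charpoly.IsRoot t) : ∃ v, eucNorm v = 1 ∧ A *ᵥ v = t • v := by
  obtain ⟨v, hv, hA⟩ := exists_mulVec_eq_smul_of_isRoot_charpoly h
  have hpos := eucNorm_pos hv
  refine ⟨(eucNorm v)⁻¹ • v, ?_, ?_⟩
  · rw [eucNorm_smul, abs_of_pos (inv_pos.2 hpos), inv_mul_cancel₀ hpos.ne']
  · rw [Matrix.mulVec_smul, hA, smul_comm]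

/-- The smallest root of the characteristic polynomial, being
simple, persists as a real root below any `m` in the spectral gap. -/
theorem eventually_exists_isRoot_charpoly {S : Matrix (Fin n) (Fin n) ℝ} {lam : Fin n → ℝ}
    (h : S.charpoly = ∏ i, (Polynomial.X - Polynomial.C (lam i))) (T : Matrix (Fin n) (Fin n) ℝ)
    {i₀ : Fin n} {m : ℝ} (hm : lam i₀ < m) (hlt : ∀ i, i ≠ i₀ → m < lam i) :
    ∀ᶠ ε : ℝ in 𝓝 0, ∃ t ≤ m, (S + ε • T).charpoly.IsRoot t := by
  set q : ℝ → ℝ → ℝ := fun t ε => (S + ε • T).charpoly.eval t with hq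
  have hcont : ∀ t, Continuous (q t) := fun t => by
    simp only [hq, Matrix.eval_charpoly]
    fun_prop
  -- Between `lam i₀ - 1` and `m` only the factor of `i₀` changes sign. The strict inequality
  -- persists for small `ε`.
  have hneg : q (lam i₀ - 1) 0 * q m 0 < 0 := by
    simp only [hq, zero_smul, add_zero, h, Polynomial.eval_prod, Polynomial.eval_sub,
      Polynomial.eval_X, Polynomial.eval_C, ← Finset.prod_mul_distrib]
    rw [← Finset.mul_prod_erase _ _ (Finset.mem_univ i₀)]
    refine mul_neg_of_neg_of_pos (by nlinarith) (Finset.prod_pos fun i hi => ?_)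
    have := hlt i (Finset.ne_of_mem_erase hi)
    exact mul_pos_of_neg_of_neg (by linarith) (by linarith)
  have hev : ∀ᶠ ε in 𝓝 (0 : ℝ), q (lam i₀ - 1) ε * q m ε < 0 :=
    ((hcont _).mul (hcont _)).continuousAt.eventually_lt continuousAt_const hneg
  filter_upwards [hev] with ε hε
  have hle : lam i₀ - 1 ≤ m := by linarith
  have hc : ContinuousOn (fun t => q t ε) (Set.Icc (lam i₀ - 1) m) :=
    (Polynomial.continuous _).continuousOn
  rcases mul_neg_iff.1 hε with ⟨h1, h2⟩ | ⟨h1, h2⟩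
  · obtain ⟨t, ht, ht'⟩ := intermediate_value_Icc' hle hc ⟨h2.le, h1.le⟩
    exact ⟨t, ht.2, ht'⟩
  · obtain ⟨t, ht, ht'⟩ := intermediate_value_Icc hle hc ⟨h1.le, h2.le⟩
    exact ⟨t, ht.2, ht'⟩

theorem dotProduct_skew_mulVec_self {T : Matrix (Fin n) (Fin n) ℝ} (hT : Tᵀ = -T)
    (v : Fin n → ℝ) : v ⬝ᵥ (T *ᵥ v) = 0 := by
  have : v ⬝ᵥ (T *ᵥ v) = - (v ⬝ᵥ (T *ᵥ v)) := by
    conv_lhs => rw [Matrix.dotProduct_mulVec, ← Matrix.mulVec_transpose, hT, dotProduct_comm,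
      Matrix.neg_mulVec, dotProduct_neg]
  linarith

/-- This lets every coercivity bound for `S` pass unchanged to `S + ε • T`. -/
theorem dotProduct_add_smul_skew_mulVec_self {S T : Matrix (Fin n) (Fin n) ℝ} (hT : Tᵀ = -T)
    (ε : ℝ) (v : Fin n → ℝ) : v ⬝ᵥ ((S + ε • T) *ᵥ v) = v ⬝ᵥ (S *ᵥ v) := by
  rw [Matrix.add_mulVec, dotProduct_add, Matrix.smul_mulVec, dotProduct_smul,
    dotProduct_skew_mulVec_self hT, smul_zero, add_zero]

/-- Cauchy–Schwarz on the coordinates other than `j`. -/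
theorem sq_dotProduct_sub_mul_le (y z : Fin n → ℝ) (j : Fin n) :
    (y ⬝ᵥ z - y j * z j) ^ 2 ≤ (y ⬝ᵥ y - y j ^ 2) * (z ⬝ᵥ z - z j ^ 2) := by
  have h : ∀ a b : Fin n → ℝ, a ⬝ᵥ b - a j * b j = ∑ i ∈ Finset.univ.erase j, a i * b i :=
    fun a b => by
      rw [dotProduct, ← Finset.add_sum_erase _ _ (Finset.mem_univ j)]
      ring
  rw [sq (y j), sq (z j), h, h, h]
  simpa only [sq] using Finset.sum_mul_sq_le_sq_mul_sq (Finset.univ.erase j) y z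

/-! ### Consequences of the spectral gap of `S` -/

section gap

variable {U S T : Matrix (Fin n) (Fin n) ℝ} {lam : Fin n → ℝ} {i₀ : Fin n} {l₂ : ℝ}

theorem le_dotProduct_mulVec (hU : Uᵀ * U = 1) (hS : S = specFun U lam)
    (hlam : ∀ i, i ≠ i₀ → l₂ ≤ lam i) (v : Fin n → ℝ) :
    l₂ * (v ⬝ᵥ v) - (l₂ - lam i₀) * (Uᵀ *ᵥ v) i₀ ^ 2 ≤ v ⬝ᵥ (S *ᵥ v) := by
  rw [hS, dotProduct_specFun_mulVec hU, ← dotProduct_transpose_mulVec hU, dotProduct,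
    ← Finset.add_sum_erase _ _ (Finset.mem_univ i₀),
    ← Finset.add_sum_erase _ _ (Finset.mem_univ i₀), mul_add, Finset.mul_sum]
  have : ∑ i ∈ Finset.univ.erase i₀, l₂ * ((Uᵀ *ᵥ v) i * (Uᵀ *ᵥ v) i)
      ≤ ∑ i ∈ Finset.univ.erase i₀, lam i * ((Uᵀ *ᵥ v) i * (Uᵀ *ᵥ v) i) :=
    Finset.sum_le_sum fun i hi =>
      mul_le_mul_of_nonneg_right (hlam i (Finset.ne_of_mem_erase hi)) (mul_self_nonneg _)
  nlinarith

theorem sq_coord_le (hU : Uᵀ * U = 1) (v : Fin n → ℝ) (i : Fin n) :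
    (Uᵀ *ᵥ v) i ^ 2 ≤ v ⬝ᵥ v := by
  rw [← dotProduct_transpose_mulVec hU v v, dotProduct, sq]
  exact Finset.single_le_sum (f := fun i => (Uᵀ *ᵥ v) i * (Uᵀ *ᵥ v) i)
    (fun i _ => mul_self_nonneg _) (Finset.mem_univ i)

theorem mul_dotProduct_le_dotProduct_mulVec (hU : Uᵀ * U = 1) (hS : S = specFun U lam)
    (hl : lam i₀ < l₂) (hlam : ∀ i, i ≠ i₀ → l₂ ≤ lam i) (v : Fin n → ℝ) :
    lam i₀ * (v ⬝ᵥ v) ≤ v ⬝ᵥ (S *ᵥ v) := by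
  have h1 := le_dotProduct_mulVec hU hS hlam v
  have h2 := sq_coord_le hU v i₀
  nlinarith

/-- The quadratic form of `S` is coercive on the orthogonal complement of a vector which is close
to the first eigenvector. -/
theorem mul_dotProduct_lt_of_orthogonal (hU : Uᵀ * U = 1) (hS : S = specFun U lam)
    (hl : lam i₀ < l₂) (hlam : ∀ i, i ≠ i₀ → l₂ ≤ lam i) {w v : Fin n → ℝ} (hw : w ⬝ᵥ w = 1)
    (hw' : 1 - (Uᵀ *ᵥ w) i₀ ^ 2 ≤ 1 / 4) (hv : v ≠ 0) (hwv : w ⬝ᵥ v = 0) :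
    (lam i₀ + l₂) / 2 * (v ⬝ᵥ v) < v ⬝ᵥ (S *ᵥ v) := by
  have h1 := le_dotProduct_mulVec hU hS hlam v
  have h2 := sq_dotProduct_sub_mul_le (Uᵀ *ᵥ w) (Uᵀ *ᵥ v) i₀
  rw [dotProduct_transpose_mulVec hU, dotProduct_transpose_mulVec hU,
    dotProduct_transpose_mulVec hU, hwv, hw] at h2
  have h3 : 0 < v ⬝ᵥ v := by
    rw [← eucNorm_sq]; exact pow_pos (eucNorm_pos hv) 2
  set a := (Uᵀ *ᵥ w) i₀
  set b := (Uᵀ *ᵥ v) i₀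
  have h4 : b ^ 2 ≤ 1 / 4 * (v ⬝ᵥ v) := by
    have : b ^ 2 ≤ (1 - a ^ 2) * (v ⬝ᵥ v) := by nlinarith
    exact this.trans (mul_le_mul_of_nonneg_right hw' h3.le)
  have h5 := mul_le_mul_of_nonneg_left h4 (sub_pos.2 hl).le
  nlinarith [mul_pos (sub_pos.2 hl) h3]

/-- The `i₀`-coordinates contribute at least `3/4` in modulus, the others at most `1/4`. This keeps
`⟨u, u*⟩` away from zero uniformly. -/
theorem half_le_abs_dotProduct (hU : Uᵀ * U = 1) {u w : Fin n → ℝ} (hu : u ⬝ᵥ u = 1)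
    (hu' : 1 - (Uᵀ *ᵥ u) i₀ ^ 2 ≤ 1 / 4) (hw : w ⬝ᵥ w = 1)
    (hw' : 1 - (Uᵀ *ᵥ w) i₀ ^ 2 ≤ 1 / 4) : 1 / 2 ≤ |u ⬝ᵥ w| := by
  have h2 := sq_dotProduct_sub_mul_le (Uᵀ *ᵥ u) (Uᵀ *ᵥ w) i₀
  rw [dotProduct_transpose_mulVec hU, dotProduct_transpose_mulVec hU,
    dotProduct_transpose_mulVec hU, hu, hw] at h2
  have hua := sq_coord_le hU u i₀
  have hwb := sq_coord_le hU w i₀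
  set a := (Uᵀ *ᵥ u) i₀
  set b := (Uᵀ *ᵥ w) i₀
  have h3 : |u ⬝ᵥ w - a * b| ≤ 1 / 4 := by
    refine abs_le_of_sq_le_sq (h2.trans ?_) (by norm_num)
    nlinarith
  have h4 : 3 / 4 ≤ |a * b| := by
    refine le_of_sq_le_sq ?_ (abs_nonneg _)
    rw [sq_abs, mul_pow]
    nlinarith
  have h5 := abs_sub_abs_le_abs_sub (a * b) (u ⬝ᵥ w)
  rw [abs_sub_comm] at h5
  linarith

/-- A unit eigenvector for an eigenvalue in the lower half of the gap is close to the first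
eigenvector of `S`. -/
theorem one_sub_sq_coord_le (hU : Uᵀ * U = 1) (hS : S = specFun U lam)
    (hl : lam i₀ < l₂) (hlam : ∀ i, i ≠ i₀ → l₂ ≤ lam i) {ε t : ℝ} {u : Fin n → ℝ}
    (hu : u ⬝ᵥ u = 1) (hA : (S + ε • T) *ᵥ u = t • u) (ht : t ≤ (lam i₀ + l₂) / 2) :
    1 - (Uᵀ *ᵥ u) i₀ ^ 2 ≤ (‖T‖ / ((l₂ - lam i₀) / 2)) ^ 2 * ε ^ 2 := by
  have hδ : 0 < (l₂ - lam i₀) / 2 := by linarith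
  set δ := (l₂ - lam i₀) / 2 with hδdef
  -- The eigenvalue equation in the eigenbasis of `S`; for `i ≠ i₀` the factor `lam i - t` is at
  -- least half the gap.
  have hcoord : ∀ i, (lam i - t) * (Uᵀ *ᵥ u) i = - (ε * (Uᵀ *ᵥ (T *ᵥ u)) i) := fun i => by
    have h := congrFun (congrArg (fun v => Uᵀ *ᵥ v) hA) i
    simp only [Matrix.add_mulVec, Matrix.smul_mulVec, Matrix.mulVec_add, Matrix.mulVec_smul] at h
    rw [hS, transpose_mulVec_specFun hU] at h
    simp only [Pi.add_apply, Pi.mul_apply, Pi.smul_apply, smul_eq_mul] at h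
    linarith
  have hsq : ∀ i, i ≠ i₀ →
      δ ^ 2 * ((Uᵀ *ᵥ u) i * (Uᵀ *ᵥ u) i) ≤
        ε ^ 2 * ((Uᵀ *ᵥ (T *ᵥ u)) i * (Uᵀ *ᵥ (T *ᵥ u)) i) := fun i hi => by
    have h1 : δ ≤ lam i - t := by linarith [hlam i hi]
    have h2 : δ ^ 2 ≤ (lam i - t) ^ 2 := pow_le_pow_left₀ hδ.le h1 2
    calc _ ≤ (lam i - t) ^ 2 * ((Uᵀ *ᵥ u) i * (Uᵀ *ᵥ u) i) :=
          mul_le_mul_of_nonneg_right h2 (mul_self_nonneg _)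
      _ = ((lam i - t) * (Uᵀ *ᵥ u) i) ^ 2 := by ring
      _ = _ := by rw [hcoord]; ring
  have hsum : δ ^ 2 * (1 - (Uᵀ *ᵥ u) i₀ ^ 2) ≤ ε ^ 2 * ‖T‖ ^ 2 := by
    have h1 : 1 - (Uᵀ *ᵥ u) i₀ ^ 2
        = ∑ i ∈ Finset.univ.erase i₀, (Uᵀ *ᵥ u) i * (Uᵀ *ᵥ u) i := by
      rw [← hu, ← dotProduct_transpose_mulVec hU, dotProduct,
        ← Finset.add_sum_erase _ _ (Finset.mem_univ i₀)]
      ring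
    have h2 := dotProduct_mulVec_self_le T u
    rw [hu, mul_one, ← dotProduct_transpose_mulVec hU] at h2
    rw [h1, Finset.mul_sum]
    refine le_trans (Finset.sum_le_sum fun i hi => hsq i (Finset.ne_of_mem_erase hi)) ?_
    rw [← Finset.mul_sum]
    refine mul_le_mul_of_nonneg_left (le_trans ?_ h2) (sq_nonneg _)
    exact Finset.sum_le_sum_of_subset_of_nonneg (Finset.erase_subset _ _)
      fun i _ _ => mul_self_nonneg _
  rw [div_pow, div_mul_eq_mul_div, le_div_iff₀ (pow_pos hδ 2)]
  linarith

theorem dotProduct_eigenvector {A : Matrix (Fin n) (Fin n) ℝ} {t : ℝ} {u : Fin n → ℝ}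
    (hu : u ⬝ᵥ u = 1) (hA : A *ᵥ u = t • u) : u ⬝ᵥ (A *ᵥ u) = t := by
  rw [hA, dotProduct_smul, hu, smul_eq_mul, mul_one]

/-- The eigenvalue is perturbed only to second order. -/
theorem eigenvalue_sub_le (hU : Uᵀ * U = 1) (hS : S = specFun U lam) (hT : Tᵀ = -T)
    {ε t : ℝ} {u : Fin n → ℝ}
    (hu : u ⬝ᵥ u = 1) (hA : (S + ε • T) *ᵥ u = t • u) :
    t - lam i₀ ≤ (∑ i, |lam i - lam i₀|) * (1 - (Uᵀ *ᵥ u) i₀ ^ 2) := by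
  have h1 := dotProduct_eigenvector hu hA
  rw [dotProduct_add_smul_skew_mulVec_self hT, hS, dotProduct_specFun_mulVec hU] at h1
  have hu' := hu
  rw [← dotProduct_transpose_mulVec hU] at hu'
  set y := Uᵀ *ᵥ u
  have h2 : t - lam i₀ = ∑ i, (lam i - lam i₀) * (y i * y i) := by
    simp only [sub_mul, Finset.sum_sub_distrib, ← Finset.mul_sum]
    rw [h1]
    change _ = t - lam i₀ * (y ⬝ᵥ y)
    rw [hu', mul_one]
  rw [h2, Finset.sum_mul]
  refine Finset.sum_le_sum fun i _ => ?_
  by_cases hi : i = i₀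
  · simp [hi]
  have h3 : y i * y i ≤ 1 - y i₀ ^ 2 := by
    rw [← hu', dotProduct, ← Finset.add_sum_erase _ _ (Finset.mem_univ i₀)]
    have := Finset.single_le_sum (f := fun i => y i * y i) (fun i _ => mul_self_nonneg _)
      (Finset.mem_erase.2 ⟨hi, Finset.mem_univ i⟩)
    linarith
  exact (mul_le_mul_of_nonneg_right (le_abs_self _) (mul_self_nonneg _)).trans
    (mul_le_mul_of_nonneg_left h3 (abs_nonneg _))

end gap

/-! ### Simplicity and minimal modulus from coercivity -/

section principal

variable {A : Matrix (Fin n) (Fin n) ℝ} {t : ℝ} {u w : Fin n → ℝ}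

theorem dotProduct_mulVec_left_eigenvector (hw : Aᵀ *ᵥ w = t • w) (v : Fin n → ℝ) :
    w ⬝ᵥ (A *ᵥ v) = t * (w ⬝ᵥ v) := by
  rw [Matrix.dotProduct_mulVec, ← Matrix.mulVec_transpose, hw, smul_dotProduct, smul_eq_mul]

/-- Algebraic simplicity of an eigenvalue, from coercivity on the complement of the left
eigenvector. -/
theorem rootMultiplicity_charpoly_eq_one (hu : A *ᵥ u = t • u) (hw : Aᵀ *ᵥ w = t • w)
    (huw : w ⬝ᵥ u ≠ 0) (hco : ∀ v, v ≠ 0 → w ⬝ᵥ v = 0 → t * (v ⬝ᵥ v) < v ⬝ᵥ (A *ᵥ v)) :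
    A.charpoly.rootMultiplicity t = 1 := by
  have hu0 : u ≠ 0 := by
    rintro rfl
    simp at huw
  set f : Module.End ℝ (Fin n → ℝ) := Matrix.toLin' A with hf
  have hchar : f.charpoly = A.charpoly := by simp [hf]
  rw [← hchar, ← LinearMap.finrank_maxGenEigenspace_eq]
  -- Pairing with `w` forces `c = 0`, so there is no Jordan chain above `u`. Removing the
  -- `u`-component of `v` then leaves an eigenvector orthogonal to `w`, which coercivity forbids
  -- unless it vanishes.
  have hstep : ∀ (v : Fin n → ℝ) (c : ℝ), A *ᵥ v - t • v = c • u →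
      ∃ a : ℝ, a • u = v := fun v c hv => by
    have hc : c = 0 := by
      have h := congrArg (fun x => w ⬝ᵥ x) hv
      simp only [dotProduct_sub, dotProduct_smul, dotProduct_mulVec_left_eigenvector hw,
        smul_eq_mul, sub_self] at h
      exact (mul_eq_zero.1 h.symm).resolve_right huw
    rw [hc, zero_smul, sub_eq_zero] at hv
    refine ⟨(w ⬝ᵥ v) / (w ⬝ᵥ u), ?_⟩
    by_contra hne
    set v' := v - ((w ⬝ᵥ v) / (w ⬝ᵥ u)) • u with hv'
    have h1 : v' ≠ 0 := fun h => hne (sub_eq_zero.1 h).symm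
    have h2 : w ⬝ᵥ v' = 0 := by
      rw [hv', dotProduct_sub, dotProduct_smul, smul_eq_mul, div_mul_cancel₀ _ huw, sub_self]
    have h3 : A *ᵥ v' = t • v' := by
      rw [hv', Matrix.mulVec_sub, Matrix.mulVec_smul, hv, hu, smul_sub, smul_comm]
    have h4 := hco v' h1 h2
    rw [h3, dotProduct_smul, smul_eq_mul] at h4
    exact lt_irrefl _ h4
  have hspan : f.maxGenEigenspace t = Submodule.span ℝ {u} := by
    refine le_antisymm (fun v hv => ?_) ?_
    · rw [Module.End.mem_maxGenEigenspace] at hv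
      obtain ⟨k, hk⟩ := hv
      induction k generalizing v with
      | zero => simp at hk; simp [hk]
      | succ k ih =>
        rw [pow_succ] at hk
        obtain ⟨c, hc⟩ := Submodule.mem_span_singleton.1 (ih _ hk)
        refine Submodule.mem_span_singleton.2 (hstep v c ?_)
        rw [hc]
        simp [hf]
    · rw [Submodule.span_singleton_le_iff_mem, Module.End.mem_maxGenEigenspace]
      exact ⟨1, by simp [hf, hu]⟩
  rw [hspan, finrank_span_singleton hu0]

/-- Complex eigenvalues other than `t` are bounded below by a coercivity constant of `A` on the
complement of the left eigenvector. -/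
theorem lt_norm_of_isRoot_charpoly {m : ℝ} (hw : Aᵀ *ᵥ w = t • w)
    (hco : ∀ v, v ≠ 0 → w ⬝ᵥ v = 0 → m * (v ⬝ᵥ v) < v ⬝ᵥ (A *ᵥ v)) {z : ℂ}
    (hz : (A.map (algebraMap ℝ ℂ)).charpoly.IsRoot z) (hne : z ≠ (t : ℂ)) : m < ‖z‖ := by
  obtain ⟨v, hv, hAv⟩ := exists_mulVec_eq_smul_of_isRoot_charpoly hz
  set x : Fin n → ℝ := fun i => (v i).re with hx
  set y : Fin n → ℝ := fun i => (v i).im with hy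
  have hAx : A *ᵥ x = z.re • x - z.im • y := by
    ext i
    have := congrArg Complex.re (congrFun hAv i)
    simpa [Matrix.mulVec, dotProduct, hx, hy] using this
  have hAy : A *ᵥ y = z.im • x + z.re • y := by
    ext i
    have := congrArg Complex.im (congrFun hAv i)
    simp [Matrix.mulVec, dotProduct] at this
    simp only [Matrix.mulVec, dotProduct, Pi.add_apply, Pi.smul_apply, smul_eq_mul, hx, hy]
    linarith
  have h1 := dotProduct_mulVec_left_eigenvector hw x
  have h2 := dotProduct_mulVec_left_eigenvector hw y
  rw [hAx, dotProduct_sub, dotProduct_smul, dotProduct_smul, smul_eq_mul, smul_eq_mul] at h1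
  rw [hAy, dotProduct_add, dotProduct_smul, dotProduct_smul, smul_eq_mul, smul_eq_mul] at h2
  have hnz : (z.re - t) ^ 2 + z.im ^ 2 ≠ 0 := fun h => by
    have h3 : z.re - t = 0 := by nlinarith [sq_nonneg (z.re - t), sq_nonneg z.im]
    have h4 : z.im = 0 := by nlinarith [sq_nonneg (z.re - t), sq_nonneg z.im]
    exact hne (Complex.ext (by simpa [sub_eq_zero] using h3) (by simpa using h4))
  -- `h1` and `h2` are the real and imaginary parts of `(z - t) * (w ⬝ᵥ v) = 0`.
  have hwx : w ⬝ᵥ x = 0 := by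
    have : ((z.re - t) ^ 2 + z.im ^ 2) * (w ⬝ᵥ x) = 0 := by
      linear_combination (z.re - t) * h1 + z.im * h2
    exact (mul_eq_zero.1 this).resolve_left hnz
  have hwy : w ⬝ᵥ y = 0 := by
    have : ((z.re - t) ^ 2 + z.im ^ 2) * (w ⬝ᵥ y) = 0 := by
      linear_combination (z.re - t) * h2 - z.im * h1
    exact (mul_eq_zero.1 this).resolve_left hnz
  have hco' : ∀ v, w ⬝ᵥ v = 0 → m * (v ⬝ᵥ v) ≤ v ⬝ᵥ (A *ᵥ v) := fun v hv => by
    by_cases h0 : v = 0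
    · simp [h0]
    · exact (hco v h0 hv).le
  have hq : x ⬝ᵥ (A *ᵥ x) + y ⬝ᵥ (A *ᵥ y) = z.re * (x ⬝ᵥ x + y ⬝ᵥ y) := by
    rw [hAx, hAy, dotProduct_sub, dotProduct_add]
    simp only [dotProduct_smul, smul_eq_mul, dotProduct_comm y x]
    ring
  have hnn : ∀ v : Fin n → ℝ, 0 ≤ v ⬝ᵥ v := fun v => by rw [← eucNorm_sq]; positivity
  have hlt : m * (x ⬝ᵥ x + y ⬝ᵥ y) < z.re * (x ⬝ᵥ x + y ⬝ᵥ y) := by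
    rw [← hq, mul_add]
    by_cases hx0 : x = 0
    · have hy0 : y ≠ 0 := fun hy0 => hv (funext fun i =>
        Complex.ext (congrFun hx0 i) (congrFun hy0 i))
      exact add_lt_add_of_le_of_lt (hco' x hwx) (hco y hy0 hwy)
    · exact add_lt_add_of_lt_of_le (hco x hx0 hwx) (hco' y hwy)
  exact (lt_of_mul_lt_mul_right hlt (add_nonneg (hnn x) (hnn y))).trans_le (Complex.re_le_norm z)

end principal

/-- Existence of the principal eigenvalue for small `ε`, and its second-order closeness to the
first eigenvalue of `S`. -/
theorem eventually_eigenSolution {U S T : Matrix (Fin n) (Fin n) ℝ} {lam : Fin n → ℝ}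
    {i₀ : Fin n} {l₂ : ℝ} (hU : Uᵀ * U = 1) (hS : S = specFun U lam)
    (hchar : S.charpoly = ∏ i, (Polynomial.X - Polynomial.C (lam i))) (hT : Tᵀ = -T)
    (hpos : 0 < lam i₀) (hl : lam i₀ < l₂) (hlam : ∀ i, i ≠ i₀ → l₂ ≤ lam i)
    {uS : Fin n → ℝ} (huS : S *ᵥ uS = lam i₀ • uS) (huS1 : eucNorm uS = 1) :
    ∃ C : ℝ, ∀ᶠ ε : ℝ in 𝓝 0,
      (∃ (t : ℝ) (u us : Fin n → ℝ), IsEigenSolution (S + ε • T) t u us ∧ 0 < u ⬝ᵥ uS) ∧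
      ∀ (t : ℝ) (u us : Fin n → ℝ), IsEigenSolution (S + ε • T) t u us →
        lam i₀ ≤ t ∧ t - lam i₀ ≤ C * ε ^ 2 ∧ 1 / 2 ≤ |u ⬝ᵥ us| := by
  set m := (lam i₀ + l₂) / 2 with hm
  set c := (‖T‖ / ((l₂ - lam i₀) / 2)) ^ 2 with hc
  have hST : Sᵀ = S := by rw [hS, specFun_transpose]
  have hAT : ∀ ε : ℝ, (S + ε • T)ᵀ = S + ε • (-T) := fun ε => by
    rw [Matrix.transpose_add, Matrix.transpose_smul, hST, hT]
  refine ⟨(∑ i, |lam i - lam i₀|) * c, ?_⟩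
  have hsmall : ∀ᶠ ε : ℝ in 𝓝 0, c * ε ^ 2 < 1 / 4 := by
    have : ContinuousAt (fun ε : ℝ => c * ε ^ 2) 0 := by fun_prop
    exact this.eventually_lt continuousAt_const (by norm_num)
  have hroot := eventually_exists_isRoot_charpoly hchar T (i₀ := i₀) (m := m) (by linarith)
    (fun i hi => by linarith [hlam i hi])
  filter_upwards [hsmall, hroot] with ε hε ⟨t₀, ht₀, hr⟩
  have unit : ∀ {v : Fin n → ℝ}, eucNorm v = 1 → v ⬝ᵥ v = 1 := fun h => by
    rw [← eucNorm_sq, h, one_pow]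
  have hright : ∀ {t : ℝ} {u : Fin n → ℝ}, eucNorm u = 1 → (S + ε • T) *ᵥ u = t • u → t ≤ m →
      1 - (Uᵀ *ᵥ u) i₀ ^ 2 ≤ c * ε ^ 2 := fun h1 h2 h3 =>
    one_sub_sq_coord_le hU hS hl hlam (unit h1) h2 h3
  have hleft : ∀ {t : ℝ} {w : Fin n → ℝ}, eucNorm w = 1 → (S + ε • T)ᵀ *ᵥ w = t • w → t ≤ m →
      1 - (Uᵀ *ᵥ w) i₀ ^ 2 ≤ c * ε ^ 2 := fun h1 h2 h3 => by
    rw [hAT] at h2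
    have := one_sub_sq_coord_le hU hS hl hlam (unit h1) h2 h3
    rwa [norm_neg] at this
  have hlow : ∀ {t : ℝ} {u : Fin n → ℝ}, eucNorm u = 1 → (S + ε • T) *ᵥ u = t • u →
      lam i₀ ≤ t := fun {t u} h1 h2 => by
    have h3 := dotProduct_eigenvector (unit h1) h2
    rw [dotProduct_add_smul_skew_mulVec_self hT] at h3
    have h4 := mul_dotProduct_le_dotProduct_mulVec hU hS hl hlam u
    rwa [unit h1, mul_one, h3] at h4
  constructor
  · obtain ⟨u, hu1, hu⟩ := exists_unit_eigenvector_of_isRoot_charpoly hr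
    rw [← Matrix.charpoly_transpose] at hr
    obtain ⟨w, hw1, hw⟩ := exists_unit_eigenvector_of_isRoot_charpoly hr
    have hu4 := (hright hu1 hu ht₀).trans hε.le
    have hw4 := (hleft hw1 hw ht₀).trans hε.le
    have huw := half_le_abs_dotProduct hU (unit hu1) hu4 (unit hw1) hw4
    have hwu : w ⬝ᵥ u ≠ 0 := fun h => by
      rw [dotProduct_comm, h, abs_zero] at huw
      linarith
    have hco : ∀ v, v ≠ 0 → w ⬝ᵥ v = 0 → m * (v ⬝ᵥ v) < v ⬝ᵥ ((S + ε • T) *ᵥ v) :=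
      fun v hv hwv => by
        rw [dotProduct_add_smul_skew_mulVec_self hT]
        exact mul_dotProduct_lt_of_orthogonal hU hS hl hlam (unit hw1) hw4 hv hwv
    have hnn : ∀ v : Fin n → ℝ, 0 ≤ v ⬝ᵥ v := fun v => by rw [← eucNorm_sq]; positivity
    have hprin : IsPrincipalEigenvalue (S + ε • T) t₀ := by
      refine ⟨?_, hpos.trans_le (hlow hu1 hu), ?_, fun z hz hne =>
        ht₀.trans_lt (lt_norm_of_isRoot_charpoly hw hco hz hne)⟩
      · rw [isUnit_iff_ne_zero]
        intro hdet
        obtain ⟨v, hv, hv'⟩ := Matrix.exists_mulVec_eq_zero_iff.2 hdet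
        have h1 := mul_dotProduct_le_dotProduct_mulVec hU hS hl hlam v
        rw [← dotProduct_add_smul_skew_mulVec_self hT ε, hv', dotProduct_zero,
          ← eucNorm_sq] at h1
        exact absurd h1 (not_le.2 (mul_pos hpos (pow_pos (eucNorm_pos hv) 2)))
      · exact rootMultiplicity_charpoly_eq_one hu hw hwu fun v hv hwv =>
          (mul_le_mul_of_nonneg_right ht₀ (hnn v)).trans_lt (hco v hv hwv)
    -- The perturbation estimate with `T = 0` applies to `uS` itself.
    have huS4 : 1 - (Uᵀ *ᵥ uS) i₀ ^ 2 ≤ 1 / 4 := by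
      have h := one_sub_sq_coord_le (T := 0) (ε := 0) hU hS hl hlam (unit huS1)
        (by simpa using huS) (by linarith)
      rw [zero_pow two_ne_zero, mul_zero] at h
      linarith
    have huuS := half_le_abs_dotProduct hU (unit hu1) hu4 (unit huS1) huS4
    rcases le_abs.1 huuS with h | h
    · exact ⟨t₀, u, w, ⟨hprin, hu, hu1, hw, hw1⟩, by linarith⟩
    · refine ⟨t₀, -u, w, ⟨hprin, ?_, ?_, hw, hw1⟩, ?_⟩
      · rw [Matrix.mulVec_neg, hu, smul_neg]
      · rw [← hu1, ← neg_one_smul ℝ u, eucNorm_smul]; simp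
      · rw [neg_dotProduct]; linarith
  · intro t u us h
    -- A principal eigenvalue cannot exceed the real eigenvalue `t₀ ≤ m` already found, as it has
    -- the smallest modulus.
    have htm : t ≤ m := by
      by_cases heq : t₀ = t
      · rwa [← heq]
      obtain ⟨v, hv1, hv⟩ := exists_unit_eigenvector_of_isRoot_charpoly hr
      have hr' : ((S + ε • T).map (algebraMap ℝ ℂ)).charpoly.IsRoot (t₀ : ℂ) := by
        rw [Matrix.charpoly_map]
        exact hr.map (f := algebraMap ℝ ℂ)
      have := h.principal.lt_norm t₀ hr' (by exact_mod_cast heq)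
      rw [Complex.norm_real, Real.norm_of_nonneg (hpos.le.trans (hlow hv1 hv))] at this
      linarith
    have hu := hright h.norm_direct h.direct htm
    have hw := hleft h.norm_adjoint h.adjoint htm
    refine ⟨hlow h.norm_direct h.direct, ?_, half_le_abs_dotProduct hU (unit h.norm_direct)
      (hu.trans hε.le) (unit h.norm_adjoint) (hw.trans hε.le)⟩
    refine (eigenvalue_sub_le hU hS hT (unit h.norm_direct) h.direct).trans ?_
    rw [mul_assoc]
    exact mul_le_mul_of_nonneg_left hu (Finset.sum_nonneg fun i _ => abs_nonneg _)

/-! ### Expansions with skew first-order term -/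

section expansion

variable {ι : Type*} {l : Filter ι} {e : ι → ℝ}

theorem isBigO_const_mul_mul_const {f : ι → Matrix (Fin n) (Fin n) ℝ} {g : ι → ℝ}
    (h : f =O[l] g) (B C : Matrix (Fin n) (Fin n) ℝ) : (fun i => B * f i * C) =O[l] g := by
  refine IsBigO.trans (IsBigO.of_bound (‖B‖ * ‖C‖) (Eventually.of_forall fun i => ?_)) h
  calc ‖B * f i * C‖ ≤ ‖B‖ * ‖f i‖ * ‖C‖ :=
        (norm_mul_le _ _).trans (mul_le_mul_of_nonneg_right (norm_mul_le _ _) (norm_nonneg _))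
    _ = _ := by ring

theorem isBigO_transpose {f : ι → Matrix (Fin n) (Fin n) ℝ} {g : ι → ℝ}
    (h : f =O[l] g) : (fun i => (f i)ᵀ) =O[l] g :=
  IsBigO.trans (IsBigO.of_bound 1 (Eventually.of_forall fun i => by rw [norm_transpose, one_mul])) h

theorem isBigO_sq_self (he : Tendsto e l (𝓝 0)) : (fun i => e i ^ 2) =O[l] e := by
  simpa [sq] using (he.isBigO_one ℝ).mul (isBigO_refl e l)

/-- `Y = Y₀ + e Y₁ + O(e²)` along `l`, with skew-symmetric `Y₁`. -/
def SkewExpansion (l : Filter ι) (e : ι → ℝ) (Y : ι → Matrix (Fin n) (Fin n) ℝ)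
    (Y₀ : Matrix (Fin n) (Fin n) ℝ) : Prop :=
  ∃ Y₁ : Matrix (Fin n) (Fin n) ℝ, Y₁ᵀ = -Y₁ ∧
    (fun i => Y i - Y₀ - e i • Y₁) =O[l] fun i => e i ^ 2

namespace SkewExpansion

variable {Y Z : ι → Matrix (Fin n) (Fin n) ℝ} {Y₀ Z₀ : Matrix (Fin n) (Fin n) ℝ}

theorem const (Y₀ : Matrix (Fin n) (Fin n) ℝ) : SkewExpansion l e (fun _ => Y₀) Y₀ :=
  ⟨0, by simp, by simpa using isBigO_zero _ _⟩

theorem add (hY : SkewExpansion l e Y Y₀) (hZ : SkewExpansion l e Z Z₀) :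
    SkewExpansion l e (fun i => Y i + Z i) (Y₀ + Z₀) := by
  obtain ⟨Y₁, hY₁, hY⟩ := hY
  obtain ⟨Z₁, hZ₁, hZ⟩ := hZ
  refine ⟨Y₁ + Z₁, by rw [Matrix.transpose_add, hY₁, hZ₁, neg_add], ?_⟩
  refine (hY.add hZ).congr_left fun i => ?_
  simp only [smul_add]; abel

theorem isBigO_sub (he : Tendsto e l (𝓝 0)) (hY : SkewExpansion l e Y Y₀) :
    (fun i => Y i - Y₀) =O[l] e := by
  obtain ⟨Y₁, -, hY⟩ := hY
  have h1 : (fun i => e i • Y₁) =O[l] e := by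
    simpa using (isBigO_refl e l).smul (isBigO_const_one ℝ Y₁ l)
  refine ((hY.trans (isBigO_sq_self he)).add h1).congr_left fun i => ?_
  abel

/-- The skew term cancels against its transpose; this controls `‖D + Dᵀ‖` in the norm estimate. -/
theorem isBigO_add_transpose (hY₀ : Y₀ᵀ = Y₀) (hY : SkewExpansion l e Y Y₀) :
    (fun i => (Y i - Y₀) + (Y i - Y₀)ᵀ) =O[l] fun i => e i ^ 2 := by
  obtain ⟨Y₁, hY₁, hY⟩ := hY
  refine (hY.add (isBigO_transpose hY)).congr_left fun i => ?_
  simp only [Matrix.transpose_sub, Matrix.transpose_smul, hY₁, hY₀, smul_neg]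
  abel

theorem smul (he : Tendsto e l (𝓝 0)) {a : ι → ℝ} {a₀ : ℝ}
    (ha : (fun i => a i - a₀) =O[l] fun i => e i ^ 2) (hY : SkewExpansion l e Y Y₀) :
    SkewExpansion l e (fun i => a i • Y i) (a₀ • Y₀) := by
  obtain ⟨Y₁, hY₁, hY'⟩ := id hY
  have hYb : Y =O[l] fun _ => (1 : ℝ) := by
    refine (((hY.isBigO_sub he).trans (he.isBigO_one ℝ)).add
      (isBigO_const_one ℝ Y₀ l)).congr_left fun i => ?_
    abel
  refine ⟨a₀ • Y₁, by rw [Matrix.transpose_smul, hY₁, smul_neg], ?_⟩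
  have h1 : (fun i => (a i - a₀) • Y i) =O[l] fun i => e i ^ 2 := by
    simpa using ha.smul hYb
  refine (h1.add (hY'.const_smul_left a₀)).congr_left fun i => ?_
  rw [smul_comm (e i)]
  simp only [Pi.smul_apply, sub_smul, smul_sub]
  abel

/-- The first-order term `Y₀ Y₁ + Y₁ Y₀` is skew. For a product of two different factors, skewness
could fail. -/
theorem mul_self (he : Tendsto e l (𝓝 0)) (hY₀ : Y₀ᵀ = Y₀) (hY : SkewExpansion l e Y Y₀) :
    SkewExpansion l e (fun i => Y i * Y i) (Y₀ * Y₀) := by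
  have h1 := (hY.isBigO_sub he).mul (hY.isBigO_sub he)
  obtain ⟨Y₁, hY₁, hY⟩ := hY
  refine ⟨Y₀ * Y₁ + Y₁ * Y₀, ?_, ?_⟩
  · rw [Matrix.transpose_add, Matrix.transpose_mul, Matrix.transpose_mul, hY₁, hY₀]
    noncomm_ring
  · have h2 := isBigO_const_mul_mul_const hY Y₀ 1
    have h3 := isBigO_const_mul_mul_const hY 1 Y₀
    have h4 : (fun i => e i * e i) = fun i => e i ^ 2 := by simp only [sq]
    rw [h4] at h1
    refine ((h1.add h2).add h3).congr_left fun i => ?_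
    simp only [mul_one, one_mul, sub_mul, mul_sub, smul_add, mul_smul_comm, smul_mul_assoc]
    abel

/-- Neumann series: the first-order term is `-Z₀ Y₁ Z₀`, and congruence by a symmetric matrix
preserves skewness. -/
theorem inverse (he : Tendsto e l (𝓝 0)) (hYZ : Y₀ * Z₀ = 1) (hZ₀ : Z₀ᵀ = Z₀)
    (hY : SkewExpansion l e Y Y₀) :
    SkewExpansion l e (fun i => (Y i)⁻¹) Z₀ := by
  have : CompleteSpace (Matrix (Fin n) (Fin n) ℝ) := FiniteDimensional.complete ℝ _
  have hsub := hY.isBigO_sub he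
  obtain ⟨Y₁, hY₁, hY⟩ := hY
  let x : (Matrix (Fin n) (Fin n) ℝ)ˣ := ⟨Y₀, Z₀, hYZ, mul_eq_one_comm.1 hYZ⟩
  have ht : Tendsto (fun i => Y i - Y₀) l (𝓝 0) := hsub.trans_tendsto he
  have h1 := (NormedRing.inverse_add_norm_diff_second_order x).comp_tendsto ht
  have h2 : (fun i => ‖Y i - Y₀‖ ^ 2) =O[l] fun i => e i ^ 2 := hsub.norm_left.pow 2
  have h3 := isBigO_const_mul_mul_const hY Z₀ Z₀
  refine ⟨-(Z₀ * Y₁ * Z₀), ?_, ?_⟩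
  · rw [Matrix.transpose_neg, Matrix.transpose_mul, Matrix.transpose_mul, hZ₀, hY₁]
    noncomm_ring
  · refine ((h1.trans h2).sub h3).congr_left fun i => ?_
    have hx : (x : Matrix (Fin n) (Fin n) ℝ) = Y₀ := rfl
    have hx' : ((x⁻¹ : (Matrix (Fin n) (Fin n) ℝ)ˣ) : Matrix (Fin n) (Fin n) ℝ) = Z₀ := rfl
    simp only [Function.comp_apply, hx, hx', add_sub_cancel, Matrix.nonsing_inv_eq_ringInverse]
    simp only [mul_sub, sub_mul, mul_smul_comm, smul_mul_assoc, smul_neg]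
    abel

theorem eventually_isUnit (he : Tendsto e l (𝓝 0)) (hYZ : Y₀ * Z₀ = 1)
    (hY : SkewExpansion l e Y Y₀) : ∀ᶠ i in l, IsUnit (Y i).det := by
  have h1 : Tendsto Y l (𝓝 Y₀) := by
    have := (hY.isBigO_sub he).trans_tendsto he
    simpa using this.add_const Y₀
  have h2 : Tendsto (fun i => (Y i).det) l (𝓝 Y₀.det) :=
    (Continuous.matrix_det continuous_id).continuousAt.tendsto.comp h1
  have h3 : Y₀.det ≠ 0 := fun h => by
    have := congrArg Matrix.det hYZ
    simp [h] at this
  filter_upwards [h2.eventually_ne h3] with i hi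
  exact isUnit_iff_ne_zero.2 hi

end SkewExpansion

end expansion

/-! ### Expansion of the spectral projection -/

section eigenprojection

variable {U : Matrix (Fin n) (Fin n) ℝ}

theorem specFun_single_eq_vecMulVec (U : Matrix (Fin n) (Fin n) ℝ) (j : Fin n) :
    specFun U (Pi.single j 1) = Matrix.vecMulVec (fun i => U i j) (fun i => U i j) := by
  ext a b
  simp [specFun, Matrix.mul_apply, Matrix.vecMulVec_apply, Matrix.diagonal_apply, Pi.single_apply]

theorem trace_specFun_single (hU : Uᵀ * U = 1) (j : Fin n) :
    (specFun U (Pi.single j 1)).trace = 1 := by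
  rw [specFun, Matrix.trace_mul_comm, ← mul_assoc, hU, one_mul, Matrix.trace_diagonal]
  simp

/-- Compression to the range of a rank-one orthogonal projection is a multiple of it. -/
theorem specFun_single_mul_mul (hU : Uᵀ * U = 1) (j : Fin n) (X : Matrix (Fin n) (Fin n) ℝ) :
    specFun U (Pi.single j 1) * X * specFun U (Pi.single j 1)
      = (specFun U (Pi.single j 1) * X * specFun U (Pi.single j 1)).trace •
        specFun U (Pi.single j 1) := by
  have h : ∃ a : ℝ, specFun U (Pi.single j 1) * X * specFun U (Pi.single j 1)
      = a • specFun U (Pi.single j 1) := by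
    rw [specFun_single_eq_vecMulVec]
    refine ⟨((fun i => U i j) ᵥ* X) ⬝ᵥ fun i => U i j, ?_⟩
    rw [Matrix.vecMulVec_mul, Matrix.vecMulVec_mul_vecMulVec]
    ext a b
    simp [Matrix.vecMulVec_apply]
    ring
  obtain ⟨a, ha⟩ := h
  rw [ha, Matrix.trace_smul, trace_specFun_single hU, smul_eq_mul, mul_one]

variable {ι : Type*} {l : Filter ι} {e : ι → ℝ}

/-- First-order expansion of the eigenprojection of `S + e T` for the perturbed simple
eigenvalue. -/
theorem SkewExpansion.eigenprojection (he : Tendsto e l (𝓝 0)) (hU : Uᵀ * U = 1)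
    {lam : Fin n → ℝ} {i₀ : Fin n} (hlam : ∀ i, i ≠ i₀ → lam i ≠ lam i₀)
    {T : Matrix (Fin n) (Fin n) ℝ} (hT : Tᵀ = -T) {t : ι → ℝ}
    (ht : (fun i => t i - lam i₀) =O[l] fun i => e i ^ 2)
    {Q : ι → Matrix (Fin n) (Fin n) ℝ} (hb : Q =O[l] fun _ => (1 : ℝ))
    (hright : ∀ᶠ i in l, (specFun U lam + e i • T) * Q i = t i • Q i)
    (hleft : ∀ᶠ i in l, Q i * (specFun U lam + e i • T) = t i • Q i)
    (hidem : ∀ᶠ i in l, Q i * Q i = Q i) (htr : ∀ᶠ i in l, (Q i).trace = 1) :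
    SkewExpansion l e Q (specFun U (Pi.single i₀ 1)) := by
  set p := specFun U (Pi.single i₀ 1) with hp
  -- The reduced resolvent of `S` at `lam i₀`. Applied to the two eigenvalue equations for `Q`, it
  -- gives `a1` and `a2`.
  set G := specFun U (fun i => if i = i₀ then 0 else (lam i - lam i₀)⁻¹) with hG
  have hpp : p * p = p := by
    rw [hp, specFun_mul hU]; congr 1; ext i; simp [Pi.single_apply]
  have hGS : G * (specFun U lam - lam i₀ • 1) = 1 - p := by
    rw [hp, hG, ← specFun_one hU, specFun_smul, specFun_sub, specFun_sub, specFun_mul hU]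
    congr 1; ext i
    by_cases hi : i = i₀
    · simp [hi]
    · simp [hi, inv_mul_cancel₀ (sub_ne_zero.2 (hlam i hi))]
  have hSG : (specFun U lam - lam i₀ • 1) * G = 1 - p := by
    rw [← hGS, hG, ← specFun_one hU, specFun_smul, specFun_sub, specFun_mul hU, specFun_mul hU,
      mul_comm]
  have hpT : pᵀ = p := specFun_transpose _
  have hGT : Gᵀ = G := specFun_transpose _
  have a1 : ∀ᶠ i in l, (1 - p) * Q i = (t i - lam i₀) • (G * Q i) - e i • (G * T * Q i) := by
    filter_upwards [hright] with i hi
    have : specFun U lam * Q i = t i • Q i - e i • (T * Q i) := by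
      rw [← hi, add_mul, smul_mul_assoc]; abel
    rw [← hGS, mul_assoc, sub_mul, this, smul_mul_assoc, one_mul]
    simp only [mul_sub, mul_smul_comm, sub_smul, mul_assoc]
    abel
  have a2 : ∀ᶠ i in l, Q i * (1 - p) = (t i - lam i₀) • (Q i * G) - e i • (Q i * T * G) := by
    filter_upwards [hleft] with i hi
    have : Q i * specFun U lam = t i • Q i - e i • (Q i * T) := by
      rw [← hi, mul_add, mul_smul_comm]; abel
    rw [← hSG, ← mul_assoc, mul_sub, this, mul_smul_comm, mul_one]
    simp only [sub_mul, smul_mul_assoc, sub_smul, mul_assoc]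
    abel
  have bnd : ∀ B C : Matrix (Fin n) (Fin n) ℝ, (fun i => B * Q i * C) =O[l] fun _ => (1 : ℝ) :=
    isBigO_const_mul_mul_const hb
  have smul_e : ∀ {f : ι → Matrix (Fin n) (Fin n) ℝ}, (f =O[l] fun _ => (1 : ℝ)) →
      (fun i => e i • f i) =O[l] e := fun h => by
    simpa using (isBigO_refl e l).smul h
  have smul_t : ∀ {f : ι → Matrix (Fin n) (Fin n) ℝ}, (f =O[l] fun _ => (1 : ℝ)) →
      (fun i => (t i - lam i₀) • f i) =O[l] fun i => e i ^ 2 := fun h => by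
    simpa using ht.smul h
  have smul_ee : ∀ {f : ι → Matrix (Fin n) (Fin n) ℝ}, (f =O[l] e) →
      (fun i => e i • f i) =O[l] fun i => e i ^ 2 := fun h => by
    simpa [sq] using (isBigO_refl e l).smul h
  have b1 : (fun i => (1 - p) * Q i) =O[l] e := by
    have h1 := smul_t (bnd G 1)
    have h2 := smul_e (bnd (G * T) 1)
    refine ((h1.trans (isBigO_sq_self he)).sub h2).congr' ?_ EventuallyEq.rfl
    filter_upwards [a1] with i hi
    rw [hi, mul_one, mul_one]
  have b2 : (fun i => Q i * (1 - p)) =O[l] e := by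
    have h1 := smul_t (bnd 1 G)
    have h2 := smul_e (bnd 1 (T * G))
    refine ((h1.trans (isBigO_sq_self he)).sub h2).congr' ?_ EventuallyEq.rfl
    filter_upwards [a2] with i hi
    rw [hi, one_mul, mul_assoc (Q i)]
  -- Writing `Q = Q * Q` makes this block a product of two `O(e)` factors.
  have b3 : (fun i => (1 - p) * Q i * (1 - p)) =O[l] fun i => e i ^ 2 := by
    have := b1.mul b2
    have h4 : (fun i => e i * e i) = fun i => e i ^ 2 := by simp only [sq]
    rw [h4] at this
    refine this.congr' ?_ EventuallyEq.rfl
    filter_upwards [hidem] with i hi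
    conv_rhs => rw [← hi]
    simp only [mul_assoc]
  -- This block is a multiple of `p`, and `trace Q = 1` ties its trace to that of the block in `b3`.
  have b4 : (fun i => p * Q i * p - p) =O[l] fun i => e i ^ 2 := by
    have h1 : (fun i => ((1 - p) * Q i * (1 - p)).trace) =O[l] fun i => e i ^ 2 := by
      refine IsBigO.trans (IsBigO.of_bound n (Eventually.of_forall fun i => ?_)) b3
      exact abs_trace_le _
    have h2 := h1.neg_left.smul (isBigO_const_one ℝ p l)
    simp only [smul_eq_mul, mul_one] at h2
    refine h2.congr' ?_ EventuallyEq.rfl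
    filter_upwards [htr] with i hi
    have h3 : ((1 - p) * Q i * (1 - p)).trace = 1 - (p * Q i * p).trace := by
      have h4 : ((1 - p) * Q i * (1 - p)).trace = (Q i * (1 - p)).trace := by
        rw [Matrix.trace_mul_comm, ← mul_assoc, Matrix.trace_mul_comm]
        congr 2
        rw [mul_sub, sub_mul, sub_mul, hpp]; simp
      have h5 : (p * Q i * p).trace = (Q i * p).trace := by
        rw [Matrix.trace_mul_comm, ← mul_assoc, hpp, Matrix.trace_mul_comm]
      rw [h4, h5, mul_sub, mul_one, Matrix.trace_sub, hi]
    rw [h3]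
    conv_rhs => rw [hp, specFun_single_mul_mul hU, ← hp]
    rw [neg_sub, sub_smul, one_smul]
  have b5 : (fun i => Q i * p - p) =O[l] e := by
    refine ((b4.trans (isBigO_sq_self he)).add (isBigO_const_mul_mul_const b1 1 p)).congr_left
      fun i => ?_
    noncomm_ring
  have b6 : (fun i => p * Q i - p) =O[l] e := by
    refine ((b4.trans (isBigO_sq_self he)).add (isBigO_const_mul_mul_const b2 p 1)).congr_left
      fun i => ?_
    noncomm_ring
  -- Replacing `Q p` by `p` inside `a1` costs one more factor `e`.
  have c1 : (fun i => (1 - p) * Q i * p + e i • (G * T * p)) =O[l] fun i => e i ^ 2 := by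
    have h1 := smul_t (bnd G p)
    have h2 := smul_ee (isBigO_const_mul_mul_const b5 (G * T) 1)
    refine (h1.sub h2).congr' ?_ EventuallyEq.rfl
    filter_upwards [a1] with i hi
    rw [hi]
    simp only [sub_mul, mul_sub, smul_sub, smul_mul_assoc, mul_one, mul_assoc]
    abel
  have c2 : (fun i => p * Q i * (1 - p) + e i • (p * T * G)) =O[l] fun i => e i ^ 2 := by
    have h1 := smul_t (bnd p G)
    have h2 := smul_ee (isBigO_const_mul_mul_const b6 1 (T * G))
    refine (h1.sub h2).congr' ?_ EventuallyEq.rfl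
    filter_upwards [a2] with i hi
    rw [mul_assoc p (Q i) (1 - p), hi]
    simp only [sub_mul, mul_sub, smul_sub, mul_smul_comm, one_mul, mul_assoc]
    abel
  refine ⟨-(G * T * p + p * T * G), ?_, ?_⟩
  · simp only [Matrix.transpose_neg, Matrix.transpose_add, Matrix.transpose_mul, hpT, hGT, hT]
    noncomm_ring
  · refine (((b4.add b3).add c1).add c2).congr_left fun i => ?_
    simp only [smul_neg, smul_add, sub_mul, mul_sub, one_mul, mul_one]
    abel

end eigenprojection

/-! ### Oblique projections attached to the eigenvectors -/

theorem opNorm_eq_norm (X : Matrix (Fin n) (Fin n) ℝ) : opNorm X = ‖X‖ := rfl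

/-- `Aᵀ u*` is a positive multiple of the unit vector `u*`. -/
theorem IsEigenSolution.tildeVec_eq {A : Matrix (Fin n) (Fin n) ℝ} {t : ℝ} {u us : Fin n → ℝ}
    (h : IsEigenSolution A t u us) : tildeVec A us = us := by
  rw [tildeVec, h.adjoint, eucNorm_smul, h.norm_adjoint, mul_one, abs_of_pos h.principal.pos,
    smul_smul, inv_mul_cancel₀ h.principal.pos.ne', one_smul]

/-- The rank-one projection onto `Span u` along `[Span w]^⊥`. -/
def rankOneProj (u w : Fin n → ℝ) : Matrix (Fin n) (Fin n) ℝ :=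
  (u ⬝ᵥ w)⁻¹ • Matrix.vecMulVec u w

section rankOneProj

variable {A : Matrix (Fin n) (Fin n) ℝ} {t : ℝ} {u w : Fin n → ℝ}

theorem rankOneProj_mul_self (huw : u ⬝ᵥ w ≠ 0) :
    rankOneProj u w * rankOneProj u w = rankOneProj u w := by
  rw [rankOneProj, smul_mul_smul_comm, Matrix.vecMulVec_mul_vecMulVec]
  ext i j
  simp only [Matrix.smul_apply, Matrix.vecMulVec_apply, Pi.smul_apply,
    smul_eq_mul, dotProduct_comm w u]
  field_simp

theorem trace_rankOneProj (huw : u ⬝ᵥ w ≠ 0) : (rankOneProj u w).trace = 1 := by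
  rw [rankOneProj, Matrix.trace_smul, Matrix.trace_vecMulVec, smul_eq_mul, inv_mul_cancel₀ huw]

theorem rankOneProj_transpose (u w : Fin n → ℝ) : (rankOneProj u w)ᵀ = rankOneProj w u := by
  rw [rankOneProj, rankOneProj, Matrix.transpose_smul, Matrix.transpose_vecMulVec,
    dotProduct_comm]

theorem mul_rankOneProj (hu : A *ᵥ u = t • u) : A * rankOneProj u w = t • rankOneProj u w := by
  rw [rankOneProj, mul_smul_comm, Matrix.mul_vecMulVec, hu, Matrix.smul_vecMulVec, smul_comm]

theorem rankOneProj_mul (hw : Aᵀ *ᵥ w = t • w) : rankOneProj u w * A = t • rankOneProj u w := by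
  have := congrArg Matrix.transpose (mul_rankOneProj (w := u) hw)
  rwa [Matrix.transpose_mul, Matrix.transpose_transpose, Matrix.transpose_smul,
    rankOneProj_transpose] at this

theorem norm_rankOneProj_le (hu : eucNorm u = 1) (hw : eucNorm w = 1)
    (huw : 1 / 2 ≤ |u ⬝ᵥ w|) : ‖rankOneProj u w‖ ≤ 2 := by
  have h1 := norm_vecMulVec_le u w
  rw [hu, hw, one_mul] at h1
  rw [rankOneProj, norm_smul, norm_inv, Real.norm_eq_abs]
  have h2 : |u ⬝ᵥ w|⁻¹ ≤ 2 := by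
    rw [inv_le_comm₀ (by linarith) (by norm_num)]
    linarith
  calc _ ≤ 2 * (1 : ℝ) := mul_le_mul h2 h1 (norm_nonneg _) (by norm_num)
    _ = 2 := by norm_num

theorem proj_eq_one_sub (u w : Fin n → ℝ) : proj u w = 1 - rankOneProj u w := rfl

theorem proj_transpose (u w : Fin n → ℝ) : (proj u w)ᵀ = proj w u := by
  rw [proj_eq_one_sub, proj_eq_one_sub, Matrix.transpose_sub, Matrix.transpose_one,
    rankOneProj_transpose]

theorem proj_mul_self (huw : u ⬝ᵥ w ≠ 0) : proj u w * proj u w = proj u w := by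
  rw [proj_eq_one_sub, mul_sub, sub_mul, sub_mul, rankOneProj_mul_self huw]
  simp

theorem proj_mulVec (v : Fin n → ℝ) :
    proj u w *ᵥ v = v - ((u ⬝ᵥ w)⁻¹ * (w ⬝ᵥ v)) • u := by
  rw [proj, Matrix.sub_mulVec, Matrix.one_mulVec, Matrix.smul_mulVec, Matrix.vecMulVec_mulVec]
  ext i
  simp [mul_assoc, mul_comm]

theorem dotProduct_proj_mulVec (huw : u ⬝ᵥ w ≠ 0) (v : Fin n → ℝ) :
    w ⬝ᵥ (proj u w *ᵥ v) = 0 := by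
  rw [proj_mulVec, dotProduct_sub, dotProduct_smul, smul_eq_mul, dotProduct_comm w u]
  field_simp
  ring

end rankOneProj

/-! ### Reduced inverses as compressed ordinary inverses -/

section reducedInverse

variable {Q : Matrix (Fin n) (Fin n) ℝ} {u w : Fin n → ℝ}

/-- An invertible `Q` commuting with the projection preserves its range, so `Q⁻¹` restricts to that
range. -/
theorem isReducedInverse_inv_mul_proj (huw : u ⬝ᵥ w ≠ 0) (hQ : IsUnit Q.det)
    (hcomm : Q * proj u w = proj u w * Q) : IsReducedInverse Q u w (Q⁻¹ * proj u w) := by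
  have hcomm' : Q⁻¹ * proj u w = proj u w * Q⁻¹ := by
    calc Q⁻¹ * proj u w = Q⁻¹ * (proj u w * Q) * Q⁻¹ := by
          rw [mul_assoc, mul_assoc, Matrix.mul_nonsing_inv _ hQ, mul_one]
      _ = _ := by rw [← hcomm, ← mul_assoc, Matrix.nonsing_inv_mul _ hQ, one_mul]
  have hfix : ∀ v, w ⬝ᵥ v = 0 → proj u w *ᵥ v = v := fun v hv => by
    rw [proj_mulVec, hv, mul_zero, zero_smul, sub_zero]
  refine ⟨fun v _ => ?_, fun v hv => ?_, fun v hv => ?_, ?_⟩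
  · rw [hcomm', ← Matrix.mulVec_mulVec, dotProduct_proj_mulVec huw]
  · rw [Matrix.mulVec_mulVec, ← mul_assoc, Matrix.mul_nonsing_inv _ hQ, one_mul, hfix v hv]
  · rw [Matrix.mulVec_mulVec, mul_assoc, ← hcomm, ← mul_assoc, Matrix.nonsing_inv_mul _ hQ,
      one_mul, hfix v hv]
  · rw [← Matrix.mulVec_mulVec, proj_mulVec, dotProduct_comm w u, inv_mul_cancel₀ huw, one_smul,
      sub_self, Matrix.mulVec_zero]

theorem IsReducedInverse.eq {G G' : Matrix (Fin n) (Fin n) ℝ} (huw : u ⬝ᵥ w ≠ 0)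
    (hG : IsReducedInverse Q u w G) (hG' : IsReducedInverse Q u w G') : G = G' := by
  have key : ∀ v, w ⬝ᵥ v = 0 → G *ᵥ v = G' *ᵥ v := fun v hv => by
    conv_lhs => rw [← hG'.right_inv v hv]
    exact hG.left_inv _ (hG'.mapsTo v hv)
  have hsplit : ∀ (H : Matrix (Fin n) (Fin n) ℝ) (v : Fin n → ℝ), H *ᵥ u = 0 →
      H *ᵥ v = H *ᵥ (proj u w *ᵥ v) := fun H v hH => by
    rw [proj_mulVec, Matrix.mulVec_sub, Matrix.mulVec_smul, hH, smul_zero, sub_zero]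
  refine Matrix.mulVec_injective (funext fun v => ?_)
  rw [hsplit G v hG.apply_eq_zero, hsplit G' v hG'.apply_eq_zero,
    key _ (dotProduct_proj_mulVec huw v)]

theorem reducedInverse_eq_inv_mul_proj (huw : u ⬝ᵥ w ≠ 0) (hQ : IsUnit Q.det)
    (hcomm : Q * proj u w = proj u w * Q) : reducedInverse Q u w = Q⁻¹ * proj u w := by
  have h := isReducedInverse_inv_mul_proj huw hQ hcomm
  have hex : ∃ G, IsReducedInverse Q u w G := ⟨_, h⟩
  rw [reducedInverse, dif_pos hex]
  exact hex.choose_spec.eq huw h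

theorem existsUnique_isReducedInverse (huw : u ⬝ᵥ w ≠ 0) (hQ : IsUnit Q.det)
    (hcomm : Q * proj u w = proj u w * Q) : ∃! G, IsReducedInverse Q u w G :=
  ⟨_, isReducedInverse_inv_mul_proj huw hQ hcomm, fun _ h =>
    h.eq huw (isReducedInverse_inv_mul_proj huw hQ hcomm)⟩

end reducedInverse

/-! ### Algebraic reduction of the prefactor -/

section prefactor

variable {A : Matrix (Fin n) (Fin n) ℝ} {t c : ℝ} {u w : Fin n → ℝ}

theorem adjointOp_eq_transpose (A : Matrix (Fin n) (Fin n) ℝ) (c : ℝ) (u w : Fin n → ℝ) :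
    adjointOp A c u w = (directOp A c u w)ᵀ := by
  rw [adjointOp, directOp, Matrix.transpose_sub, Matrix.transpose_mul, Matrix.transpose_mul,
    proj_transpose, Matrix.transpose_smul, Matrix.transpose_one, mul_assoc]

theorem inv_mul_proj (hA : IsUnit A.det) (ht : t ≠ 0) (hu : A *ᵥ u = t • u) :
    A⁻¹ * proj u w = A⁻¹ - t⁻¹ • rankOneProj u w := by
  have h : rankOneProj u w = t • (A⁻¹ * rankOneProj u w) := by
    rw [← mul_smul_comm, ← mul_rankOneProj hu, ← mul_assoc, Matrix.nonsing_inv_mul _ hA, one_mul]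
  rw [proj_eq_one_sub, mul_sub, mul_one]
  congr 1
  conv_rhs => rw [h, smul_smul, inv_mul_cancel₀ ht, one_smul]

theorem inv_mul_proj_comm (hA : IsUnit A.det) (ht : t ≠ 0) (hu : A *ᵥ u = t • u)
    (hw : Aᵀ *ᵥ w = t • w) : proj u w * A⁻¹ = A⁻¹ * proj u w := by
  have h := congrArg Matrix.transpose
    (inv_mul_proj (A := Aᵀ) (w := u) (by rwa [Matrix.det_transpose]) ht hw)
  rw [Matrix.transpose_mul, proj_transpose, Matrix.transpose_nonsing_inv,
    Matrix.transpose_transpose, Matrix.transpose_sub, Matrix.transpose_smul,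
    rankOneProj_transpose, Matrix.transpose_nonsing_inv, Matrix.transpose_transpose] at h
  rw [h, inv_mul_proj hA ht hu]

/-- In this form each summand has a known skew expansion; products of different factors are avoided.
-/
theorem directOp_eq (huw : u ⬝ᵥ w ≠ 0) (hA : IsUnit A.det) (ht : t ≠ 0) (hu : A *ᵥ u = t • u)
    (hw : Aᵀ *ᵥ w = t • w) :
    directOp A c u w = A⁻¹ + (-t⁻¹) • rankOneProj u w + -(c • 1) := by
  rw [directOp, inv_mul_proj_comm hA ht hu hw, mul_assoc, proj_mul_self huw,
    inv_mul_proj hA ht hu, neg_smul, sub_eq_add_neg, sub_eq_add_neg]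

theorem directOp_comm (huw : u ⬝ᵥ w ≠ 0) (hA : IsUnit A.det) (ht : t ≠ 0) (hu : A *ᵥ u = t • u)
    (hw : Aᵀ *ᵥ w = t • w) :
    directOp A c u w * proj u w = proj u w * directOp A c u w := by
  have hP := proj_mul_self huw
  rw [directOp, inv_mul_proj_comm hA ht hu hw, mul_assoc, hP, sub_mul, mul_sub, ← mul_assoc,
    inv_mul_proj_comm hA ht hu hw]
  simp

theorem prefactorWellDefined (huw : u ⬝ᵥ w ≠ 0) (hA : IsUnit A.det) (ht : t ≠ 0)
    (hu : A *ᵥ u = t • u) (hw : Aᵀ *ᵥ w = t • w) (hQ : IsUnit (directOp A c u w).det) :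
    PrefactorWellDefined A c u w := by
  have hcomm := directOp_comm (c := c) huw hA ht hu hw
  refine ⟨huw, existsUnique_isReducedInverse huw hQ hcomm, ?_⟩
  rw [adjointOp_eq_transpose]
  refine existsUnique_isReducedInverse (by rwa [dotProduct_comm]) (by rwa [Matrix.det_transpose]) ?_
  rw [← proj_transpose, ← Matrix.transpose_mul, ← Matrix.transpose_mul, hcomm]

/-- The matrix in the prefactor is a quadratic polynomial in the inverse of `P M P - k_N I`. -/
theorem prefactor_eq_norm (huw : u ⬝ᵥ w ≠ 0) (hA : IsUnit A.det) (ht : t ≠ 0)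
    (hu : A *ᵥ u = t • u) (hw : Aᵀ *ᵥ w = t • w) (hQ : IsUnit (directOp A c u w).det) (k : ℝ) :
    prefactor A k c u w = ‖1 + (2 * c - k) • (directOp A c u w)⁻¹
      + (c * (c - k)) • ((directOp A c u w)⁻¹ * (directOp A c u w)⁻¹)‖ := by
  have hcomm := directOp_comm (c := c) huw hA ht hu hw
  have hadj : reducedInverse (adjointOp A c u w) w u
      = ((directOp A c u w)⁻¹)ᵀ * proj w u := by
    rw [adjointOp_eq_transpose, Matrix.transpose_nonsing_inv]
    refine reducedInverse_eq_inv_mul_proj (by rwa [dotProduct_comm])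
      (by rwa [Matrix.det_transpose]) ?_
    rw [← proj_transpose, ← Matrix.transpose_mul, ← Matrix.transpose_mul, hcomm]
  rw [prefactor, opNorm_eq_norm, hadj, reducedInverse_eq_inv_mul_proj huw hQ hcomm]
  congr 1
  have hP := proj_mul_self huw
  have hPM := inv_mul_proj_comm hA ht hu hw
  have hRQ := Matrix.nonsing_inv_mul _ hQ
  have hPR : proj u w * (directOp A c u w)⁻¹ = (directOp A c u w)⁻¹ * proj u w := by
    set Q := directOp A c u w
    calc proj u w * Q⁻¹ = Q⁻¹ * (Q * proj u w) * Q⁻¹ := by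
          rw [← mul_assoc, Matrix.nonsing_inv_mul _ hQ, one_mul]
      _ = _ := by
          rw [hcomm, mul_assoc, mul_assoc, Matrix.mul_nonsing_inv _ hQ, mul_one]
  have hN : A⁻¹ * proj u w = directOp A c u w + c • 1 := by
    rw [directOp, hPM, mul_assoc, hP, sub_add_cancel]
  set R := (directOp A c u w)⁻¹
  set P := proj u w
  -- With `N = A⁻¹ * P`, the matrix is `(R N)² - k R (R N)`, so this identity yields the polynomial
  -- in `R`.
  have hRN : R * (A⁻¹ * P) = 1 + c • R := by
    rw [hN, mul_add, hRQ, mul_smul_comm, mul_one]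
  have h1 : (proj w u * (Rᵀ * proj w u) * proj w u)ᵀ = R * P := by
    simp only [Matrix.transpose_mul, proj_transpose, Matrix.transpose_transpose]
    change P * (P * R * P) = R * P
    rw [hPR, mul_assoc R, hP, ← mul_assoc, hPR, mul_assoc, hP]
  have h2 : P * (R * P) * P = R * P := by
    rw [← mul_assoc, hPR, mul_assoc R, hP, mul_assoc, hP]
  rw [h1, h2]
  calc R * P * (A⁻¹ - k • 1) * (R * P) * A⁻¹
      = R * (P * A⁻¹) * (R * (P * A⁻¹)) - k • (R * (P * R) * (P * A⁻¹)) := by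
        simp only [mul_sub, sub_mul, mul_smul_comm, smul_mul_assoc, mul_one, mul_assoc]
    _ = R * (A⁻¹ * P) * (R * (A⁻¹ * P)) - k • (R * (R * (A⁻¹ * P))) := by
        rw [hPR, hPM, ← hPM, mul_assoc R (R * P), mul_assoc R P (P * A⁻¹), ← mul_assoc P P, hP]
    _ = _ := by
        rw [hRN]
        simp only [mul_add, add_mul, mul_one, one_mul, mul_smul_comm, smul_mul_assoc, smul_smul,
          sub_smul, smul_add, mul_sub, two_mul, add_smul]
        rw [mul_comm k c]
        abel

end prefactor

/-- The eigenvalues of the limit matrix are decreasing functions of `1 / (k_N - x)`. -/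
theorem one_sub_sub_antitone {c k r r' : ℝ} (hc : 0 < c) (hk : c ≤ k) (hr : c⁻¹ ≤ r)
    (hrr : r ≤ r') :
    1 + (2 * c - k) * -r' + c * (c - k) * (-r' * -r')
      ≤ 1 + (2 * c - k) * -r + c * (c - k) * (-r * -r) := by
  have h1 : 1 ≤ c * r := by
    have := mul_le_mul_of_nonneg_left hr hc.le
    rwa [mul_inv_cancel₀ hc.ne'] at this
  have h2 : 1 ≤ c * r' := h1.trans (mul_le_mul_of_nonneg_left hrr hc.le)
  have h3 : 0 ≤ (r' - r) * (c + (k - c) * (c * r + c * r' - 1)) :=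
    mul_nonneg (by linarith) (add_nonneg hc.le (mul_nonneg (by linarith) (by linarith)))
  nlinarith

/-! ### Asymptotics along a family of eigensolutions -/

section main

variable {ι : Type*} {l : Filter ι} {e : ι → ℝ}

/-- Asymptotics of the prefactor along any family of eigensolutions of `S + e T`, `e → 0`. -/
theorem isBigO_prefactor_sub {U S T : Matrix (Fin n) (Fin n) ℝ} {lam : Fin n → ℝ}
    {i₀ i₁ : Fin n} (hne : i₁ ≠ i₀) (hU : Uᵀ * U = 1) (hS : S = specFun U lam) (hT : Tᵀ = -T)
    (hpos : 0 < lam i₀) (hl : lam i₀ < lam i₁) (hlam : ∀ i, i ≠ i₀ → lam i₁ ≤ lam i)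
    {kN : ℝ} (hk₁ : kN ≤ (lam i₀)⁻¹) (hk₂ : (lam i₁)⁻¹ < kN) (he : Tendsto e l (𝓝 0))
    {t : ι → ℝ} {u w : ι → Fin n → ℝ}
    (hsol : ∀ᶠ i in l, IsEigenSolution (S + e i • T) (t i) (u i) (w i))
    (hlow : ∀ᶠ i in l, lam i₀ ≤ t i) (ht : (fun i => t i - lam i₀) =O[l] fun i => e i ^ 2)
    (huw : ∀ᶠ i in l, 1 / 2 ≤ |u i ⬝ᵥ w i|) :
    (∀ᶠ i in l, PrefactorWellDefined (S + e i • T) kN (u i) (w i)) ∧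
    (fun i => prefactor (S + e i • T) (1 / t i) kN (u i) (w i)
      - symPrefactor (lam i₀)⁻¹ (lam i₁)⁻¹ kN) =O[l] fun i => e i ^ 2 := by
  have hl₁ : 0 < lam i₁ := hpos.trans hl
  have hposi : ∀ i, 0 < lam i := fun i => by
    by_cases hi : i = i₀
    · rwa [hi]
    · exact hl₁.trans_le (hlam i hi)
  have hkN : 0 < kN := (inv_pos.2 hl₁).trans hk₂
  -- Eigenvalues of the limit of `P M P`: the first one is deflated to `0`.
  set x : Fin n → ℝ := fun i => if i = i₀ then 0 else (lam i)⁻¹ with hx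
  have hx0 : ∀ i, 0 ≤ x i := fun i => by
    simp only [hx]
    split_ifs
    · exact le_rfl
    · exact (inv_pos.2 (hposi i)).le
  have hx1 : ∀ i, x i ≤ (lam i₁)⁻¹ := fun i => by
    simp only [hx]
    split_ifs with hi
    · exact (inv_pos.2 hl₁).le
    · exact inv_anti₀ hl₁ (hlam i hi)
  have hxi : x i₁ = (lam i₁)⁻¹ := by simp [hx, hne]
  have hd : ∀ i, 0 < kN - x i := fun i => by linarith [hx1 i]
  set r : Fin n → ℝ := fun i => (kN - x i)⁻¹ with hr
  have hrlow : ∀ i, kN⁻¹ ≤ r i := fun i => inv_anti₀ (hd i) (by linarith [hx0 i])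
  have hrup : ∀ i, r i ≤ r i₁ := fun i => inv_anti₀ (hd i₁) (by linarith [hx1 i])
  set k := (lam i₀)⁻¹ with hk
  set f : Fin n → ℝ := fun i => 1 + (2 * kN - k) * -r i + kN * (kN - k) * (-r i * -r i) with hf
  have hfj : f i₁ = - symPrefactor k (lam i₁)⁻¹ kN := by
    simp only [hf, hr, hxi, symPrefactor]
    have : kN - (lam i₁)⁻¹ ≠ 0 := by linarith
    generalize (lam i₁)⁻¹ = y at this ⊢
    field_simp
    ring
  have hfneg : f i₁ < 0 := by
    rw [hfj, symPrefactor, neg_lt_zero]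
    have h1 : (lam i₁)⁻¹ < k := hk₂.trans_le hk₁
    have h2 : 0 < (lam i₁)⁻¹ := inv_pos.2 hl₁
    exact div_pos (mul_pos h2 (by linarith)) (pow_pos (by linarith) 2)
  -- Monotonicity in `r` puts the minimum at `i₁`; the upper bound is the value at `r = kN⁻¹`, that
  -- is `x = 0`, which vanishes.
  have hfbd : ∀ i, f i₁ ≤ f i ∧ f i ≤ 0 := fun i => by
    refine ⟨one_sub_sub_antitone hkN hk₁ (hrlow i) (hrup i), ?_⟩
    refine (one_sub_sub_antitone hkN hk₁ le_rfl (hrlow i)).trans (le_of_eq ?_)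
    field_simp
    ring
  have hne' : ∀ᶠ i in l, u i ⬝ᵥ w i ≠ 0 := by
    filter_upwards [huw] with i hi h0
    rw [h0, abs_zero] at hi
    linarith
  have eS : SkewExpansion l e (fun i => S + e i • T) S :=
    ⟨T, hT, by simpa using isBigO_zero _ _⟩
  have eM : SkewExpansion l e (fun i => (S + e i • T)⁻¹) (specFun U fun i => (lam i)⁻¹) := by
    refine eS.inverse he ?_ (specFun_transpose _)
    rw [hS, specFun_mul hU, ← specFun_one hU]
    congr 1; ext i
    simp [(hposi i).ne']
  have eQ : SkewExpansion l e (fun i => rankOneProj (u i) (w i))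
      (specFun U (Pi.single i₀ 1)) := by
    refine SkewExpansion.eigenprojection he hU (lam := lam) (T := T) (t := t)
      (fun i hi => (hl.trans_le (hlam i hi)).ne') hT ht ?_ ?_ ?_ ?_ ?_
    · refine IsBigO.of_bound 2 ?_
      filter_upwards [hsol, huw] with i hi hi'
      simpa using norm_rankOneProj_le hi.norm_direct hi.norm_adjoint hi'
    · filter_upwards [hsol] with i hi
      rw [← hS]; exact mul_rankOneProj hi.direct
    · filter_upwards [hsol] with i hi
      rw [← hS]; exact rankOneProj_mul hi.adjoint
    · filter_upwards [hne'] with i hi using rankOneProj_mul_self hi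
    · filter_upwards [hne'] with i hi using trace_rankOneProj hi
  have ek : (fun i => (t i)⁻¹ - k) =O[l] fun i => e i ^ 2 := by
    refine IsBigO.trans (IsBigO.of_bound ((lam i₀)⁻¹ * (lam i₀)⁻¹) ?_) ht
    filter_upwards [hlow] with i hi
    have hti : 0 < t i := hpos.trans_le hi
    have h1 : (t i)⁻¹ - k = -((t i)⁻¹ * (lam i₀)⁻¹ * (t i - lam i₀)) := by
      rw [hk]; field_simp; ring
    rw [h1, norm_neg, norm_mul]
    refine mul_le_mul_of_nonneg_right ?_ (norm_nonneg _)
    rw [Real.norm_of_nonneg (by positivity)]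
    exact mul_le_mul_of_nonneg_right (inv_anti₀ hpos hi) (by positivity)
  have eN : SkewExpansion l e (fun i => (S + e i • T)⁻¹ + (-(t i)⁻¹) • rankOneProj (u i) (w i)
      + -(kN • 1)) (specFun U fun i => -(kN - x i)) := by
    have h1 : (fun i => -(t i)⁻¹ - -k) =O[l] fun i => e i ^ 2 :=
      ek.neg_left.congr_left fun i => by ring
    have h2 := (eM.add (eQ.smul he h1)).add (SkewExpansion.const (-(kN • 1)))
    convert h2 using 1
    rw [← specFun_one hU, specFun_smul, specFun_smul, specFun_add, ← sub_eq_add_neg, specFun_sub]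
    congr 1; ext i
    by_cases hi : i = i₀
    · simp [hx, hk, hi]
    · simp [hx, hi]
  have hinv : specFun U (fun i => -(kN - x i)) * specFun U (fun i => - r i) = 1 := by
    rw [specFun_mul hU, ← specFun_one hU]
    congr 1; ext i
    simp only [Pi.mul_apply, hr, neg_mul_neg, Pi.one_apply, mul_inv_cancel₀ (hd i).ne']
  have eR := eN.inverse he hinv (specFun_transpose _)
  have hunit := eN.eventually_isUnit he hinv
  have h1 : (fun i => (2 * kN - (t i)⁻¹) - (2 * kN - k)) =O[l] fun i => e i ^ 2 :=
    ek.neg_left.congr_left fun i => by ring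
  have h2 : (fun i => kN * (kN - (t i)⁻¹) - kN * (kN - k)) =O[l] fun i => e i ^ 2 :=
    (ek.const_mul_left (-kN)).congr_left fun i => by ring
  have eX := ((SkewExpansion.const (1 : Matrix (Fin n) (Fin n) ℝ)).add (eR.smul he h1)).add
    ((eR.mul_self he (specFun_transpose _)).smul he h2)
  have hX0 : 1 + (2 * kN - k) • specFun U (fun i => -r i)
      + (kN * (kN - k)) • (specFun U (fun i => -r i) * specFun U fun i => -r i)
        = specFun U f := by
    rw [specFun_mul hU, ← specFun_one hU, specFun_smul, specFun_smul, specFun_add, specFun_add]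
    rfl
  rw [hX0] at eX
  have hdir : ∀ᶠ i in l, directOp (S + e i • T) kN (u i) (w i)
      = (S + e i • T)⁻¹ + (-(t i)⁻¹) • rankOneProj (u i) (w i) + -(kN • 1) := by
    filter_upwards [hsol, hne'] with i hi hi'
    exact directOp_eq hi' hi.principal.isUnit_det hi.principal.pos.ne' hi.direct hi.adjoint
  constructor
  · filter_upwards [hsol, hne', hdir, hunit] with i hi hi' hd hu
    refine prefactorWellDefined hi' hi.principal.isUnit_det hi.principal.pos.ne' hi.direct
      hi.adjoint ?_
    rwa [hd]
  · have hD := eX.isBigO_sub he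
    have hDT := eX.isBigO_add_transpose (specFun_transpose _)
    have hB := hDT.norm_left.add (((hD.norm_left.pow 2).const_mul_left 2).const_mul_left |f i₁|⁻¹)
    refine IsBigO.trans (IsBigO.of_bound 1 ?_) hB
    filter_upwards [hsol, hne', hdir, hunit] with i hi hi' hd hu
    rw [prefactor_eq_norm hi' hi.principal.isUnit_det hi.principal.pos.ne' hi.direct hi.adjoint
      (by rwa [hd]), hd, sub_eq_add_neg, ← hfj, one_div, one_mul, Real.norm_eq_abs]
    refine le_trans ?_ (le_abs_self _)
    have hb := abs_norm_specFun_add_sub_le hU hfneg hfbd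
      (1 + (2 * kN - (t i)⁻¹) • ((S + e i • T)⁻¹ + (-(t i)⁻¹) • rankOneProj (u i) (w i)
        + -(kN • 1))⁻¹ + (kN * (kN - (t i)⁻¹)) • (((S + e i • T)⁻¹
        + (-(t i)⁻¹) • rankOneProj (u i) (w i) + -(kN • 1))⁻¹ * ((S + e i • T)⁻¹
        + (-(t i)⁻¹) • rankOneProj (u i) (w i) + -(kN • 1))⁻¹) - specFun U f)
    rw [add_sub_cancel, div_eq_inv_mul] at hb
    exact hb

end main

end NonsymEig

end

/-! ### Uniform conclusion over all eigensolutions -/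

open Filter Topology Asymptotics

theorem proposition3p13 (n : ℕ) (hn : 2 ≤ n)
    (S T : Matrix (Fin n) (Fin n) ℝ) (hS : S.PosDef) (hT : Tᵀ = -T)
    (lam : Fin n → ℝ) (hlam : NonsymEig.IsOrderedSpectrum S lam)
    (kS kS2 kN : ℝ) (hkS : kS = 1 / lam ⟨0, by omega⟩) (hkS2 : kS2 = 1 / lam ⟨1, by omega⟩)
    (hgap₁ : kN ≤ kS) (hgap₂ : kS2 < kN) (hgap₃ : 0 < kS2)
    (hsimple : ∀ i : Fin n, 1 < (i : ℕ) → lam i ≠ lam ⟨1, by omega⟩)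
    (uS : Fin n → ℝ) (huS : S *ᵥ uS = lam ⟨0, by omega⟩ • uS)
    (huS_norm : NonsymEig.eucNorm uS = 1) :
    ∃ ε₀ K : ℝ, 0 < ε₀ ∧ ∀ ε : ℝ, 0 < ε → ε < ε₀ →
      (∃ (lamε : ℝ) (u us : Fin n → ℝ),
        NonsymEig.IsEigenSolution (S + ε • T) lamε u us ∧ 0 < u ⬝ᵥ uS) ∧
      ∀ (lamε : ℝ) (u us : Fin n → ℝ),
        NonsymEig.IsEigenSolution (S + ε • T) lamε u us → 0 < u ⬝ᵥ uS →
        NonsymEig.PrefactorWellDefined (S + ε • T) kN u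
            (NonsymEig.tildeVec (S + ε • T) us) ∧
        |NonsymEig.prefactor (S + ε • T) (1 / lamε) kN u
            (NonsymEig.tildeVec (S + ε • T) us)
          - NonsymEig.symPrefactor kS kS2 kN| ≤ K * ε ^ 2 := by
  obtain ⟨hmono, hchar⟩ := hlam
  obtain ⟨U, hU, hSU⟩ := NonsymEig.exists_eq_specFun hS.1 hchar
  set i₀ : Fin n := ⟨0, by omega⟩
  set i₁ : Fin n := ⟨1, by omega⟩
  have hne : i₁ ≠ i₀ := by simp [i₀, i₁]
  rw [one_div] at hkS hkS2
  have hpos : 0 < lam i₀ := inv_pos.1 (hkS ▸ (hgap₃.trans hgap₂).trans_le hgap₁)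
  have hpos₁ : 0 < lam i₁ := inv_pos.1 (hkS2 ▸ hgap₃)
  have hl : lam i₀ < lam i₁ := by
    have := hgap₂.trans_le hgap₁
    rw [hkS, hkS2] at this
    exact (inv_lt_inv₀ hpos₁ hpos).1 this
  have hlam' : ∀ i, i ≠ i₀ → lam i₁ ≤ lam i := fun i hi => by
    refine hmono ?_
    rw [Fin.le_def]
    have : (i : ℕ) ≠ 0 := fun h => hi (Fin.ext h)
    change 1 ≤ (i : ℕ)
    omega
  obtain ⟨C, hC⟩ := NonsymEig.eventually_eigenSolution hU hSU hchar hT hpos hl hlam' huS huS_norm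
  -- Only the parameter tends to `0`, while the eigenvalue and eigenvectors range over all
  -- solutions. An `O` bound along `l` therefore has constants independent of their choice.
  let l : Filter (ℝ × ℝ × (Fin n → ℝ) × (Fin n → ℝ)) := comap Prod.fst (𝓝 0) ⊓
    𝓟 {x | NonsymEig.IsEigenSolution (S + x.1 • T) x.2.1 x.2.2.1 x.2.2.2}
  have he : Tendsto Prod.fst l (𝓝 0) := tendsto_comap.mono_left inf_le_left
  have hsol : ∀ᶠ x in l, NonsymEig.IsEigenSolution (S + x.1 • T) x.2.1 x.2.2.1 x.2.2.2 :=
    mem_inf_of_right (mem_principal_self _)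
  have hall := he.eventually (hC.mono fun ε h => h.2)
  have hall' : ∀ᶠ x in l, lam i₀ ≤ x.2.1 ∧ x.2.1 - lam i₀ ≤ C * x.1 ^ 2 ∧
      1 / 2 ≤ |x.2.2.1 ⬝ᵥ x.2.2.2| := by
    filter_upwards [hall, hsol] with x h hx using h _ _ _ hx
  have ht : (fun x : ℝ × ℝ × (Fin n → ℝ) × (Fin n → ℝ) => x.2.1 - lam i₀) =O[l]
      fun x => x.1 ^ 2 := by
    refine IsBigO.of_bound C ?_
    filter_upwards [hall'] with x hx
    rw [Real.norm_of_nonneg (sub_nonneg.2 hx.1), Real.norm_of_nonneg (sq_nonneg _)]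
    exact hx.2.1
  obtain ⟨hwd, hO⟩ := NonsymEig.isBigO_prefactor_sub hne hU hSU hT hpos hl hlam'
    (hkS ▸ hgap₁) (hkS2 ▸ hgap₂) he hsol (hall'.mono fun x h => h.1) ht
    (hall'.mono fun x h => h.2.2)
  obtain ⟨K, hK⟩ := hO.bound
  have hfin := hwd.and hK
  rw [eventually_inf_principal, eventually_comap] at hfin
  obtain ⟨ε₀, hε₀, hball⟩ := Metric.eventually_nhds_iff.1 (hC.and hfin)
  refine ⟨ε₀, K, hε₀, fun ε hε hlt => ?_⟩
  obtain ⟨hex, hall⟩ := hball (y := ε) (by rwa [Real.dist_0_eq_abs, abs_of_pos hε])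
  refine ⟨hex.1, fun t u us h _ => ?_⟩
  rw [h.tildeVec_eq]
  obtain ⟨h1, h2⟩ := hall (ε, t, u, us) rfl h
  refine ⟨h1, ?_⟩
  rw [Real.norm_eq_abs, Real.norm_of_nonneg (sq_nonneg _), ← hkS, ← hkS2] at h2
  exact h2
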